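/- **Proposition (time-reversal symmetry).** Let $\Gamma\subset\mathbb R^d$ be the lattice generated by a basis $\gamma_1,\dots,\gamma_d$ of $\mathbb R^d$, let $\Gamma^*$ be the dual lattice, generated by the vectors $\gamma_j^*$ with $\gamma_i\cdot\gamma_j^*=2\pi\delta_{ij}$, and let $Y$, $Y^*$ be the corresponding centred fundamental cells, $Y=\{\sum_l\zeta_l\gamma_l:\zeta_l\in[-\frac12,\frac12]\}$ and $Y^*=\{\sum_l\zeta_l\gamma^*_l:\zeta_l\in[-\frac12,\frac12]\}$. Put $\mathcal H_{\rm f}=L^2(\mathbb R^d/\Gamma)\cong L^2(Y)$ and let $$\mathcal Z: L^2(\mathbb R^d)\to L^2(Y^*,|Y^*|^{-1}dk;\mathcal H_{\rm f}),\qquad (\mathcal Z\psi)(k,y)=\sum_{\gamma\in\Gamma}e^{-i(y+\gamma)\cdot k}\,\psi(y+\gamma)$$ (convergence in $L^2$) be the Bloch–Floquet–Zak transform. Let $I\subseteq\mathbb R$ be an interval of positive length. For $t\in I$ let $H(t)$ be a self-adjoint (possibly unbounded) operator in $L^2(\mathbb R^d)$ such that * $H(t)$ commutes with complex conjugation $\mathscr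 C\psi=\overline\psi$: if $\psi$ is in the domain of $H(t)$, then so is $\overline\psi$, and $H(t)\overline\psi=\overline{H(t)\psi}$; * $\mathcal Z H(t)\mathcal Z^{-1}=\int^\oplus_{Y^*}H(k,t)\,dk$ is continuously fibered: the $H(k,t)$, $k\in\mathbb R^d$, are self-adjoint operators in $\mathcal H_{\rm f}$ that depend continuously on $k$ in the (strong) resolvent sense, with $H(k+\gamma^*,t)=e^{-iy\cdot\gamma^*}H(k,t)\,e^{iy\cdot\gamma^*}$ for all $\gamma^*\in\Gamma^*$. For all $k\in\mathbb R^d$, $t\in I$ let $P(k,t)$ be either * (a) $P(k,t)=\mathbf 1_{(-\infty,E(t))}(H(k,t))$, where $E(t)\in\mathbb R$ lies in the resolvent set of $H(t)$; or * (b) $P(k,t)=P_m(k,t)$, the orthogonal projection onto the eigenspace of $H(k,t)$ for the eigenvalue $E_m(k,t)$, where $\mathcal H_{\rm f}$ has, for all $k$ and $t$, an orthonormal basis of eigenvectors of $H(k,t)$ with eigenvalues $E_0(k,t)\le E_1(k,t)\le\dots$, and the $m$-th Bloch band is isolated: for each $t\in I$, $\inf_{k}\operatorname{dist}\big(E_m(k,t),\,\sigma(H(k,t))\setminus\{E_m(k,t)\}\big)>0$.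 Let $\mathscr C_{\rm f}$ be complex conjugation in $\mathcal H_{\rm f}$. Then $$P(k,t)=\mathscr C_{\rm f}\,P(-k,t)\,\mathscr C_{\rm f}\qquad\text{for all }k\in\mathbb R^d,\ t\in I.$$ Moreover the piezocurvature $$\Theta(k,t)=-i\,\operatorname{tr}\big(P(k,t)\,[\partial_tP(k,t),\nabla_kP(k,t)]\big)$$ exists at $(-k,t)$ if and only if it exists at $(k,t)$ (that is, $P$ is norm differentiable in $k$ and in $t$ there and the operators $P[\partial_tP,\partial_{k_j}P]$ are trace class), and then $$\Theta(-k,t)=\Theta(k,t).$$ -/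

import Mathlib

open MeasureTheory

noncomputable section

namespace Piezo

/-! ### Lattice, cells and Hilbert spaces -/

/-- The physical space `ℝ^d` (also used for the crystal momentum). -/
abbrev Space (d : ℕ) : Type := EuclideanSpace ℝ (Fin d)

/-- `L²(ℝ^d)`. -/
abbrev L2 (d : ℕ) : Type := Lp ℂ 2 (volume : Measure (Space d))

/-- The lattice `Γ` generated by the basis `γ`. -/
def lattice {d : ℕ} (γ : Module.Basis (Fin d) ℝ (Space d)) : Submodule ℤ (Space d) :=
  Submodule.span ℤ (Set.range γ)

/-- The centred fundamental cell `{∑ ζ_l γ_l : ζ_l ∈ [-1/2, 1/2]}`. -/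
def cell {d : ℕ} (γ : Module.Basis (Fin d) ℝ (Space d)) : Set (Space d) :=
  {x | ∀ l, γ.repr x l ∈ Set.Icc (-(1 / 2) : ℝ) (1 / 2)}

lemma innerₗ_nondegenerate (d : ℕ) :
    LinearMap.BilinForm.Nondegenerate (innerₗ (Space d) : LinearMap.BilinForm ℝ (Space d)) := by
  refine ⟨fun x hx => ?_, fun x hx => ?_⟩
  · exact inner_self_eq_zero.mp (hx x)
  · exact inner_self_eq_zero.mp (hx x)

/-- The generators `γ*_j` of the dual lattice, `γ_i · γ*_j = 2π δ_ij`. -/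
def dual {d : ℕ} (γ : Module.Basis (Fin d) ℝ (Space d)) : Module.Basis (Fin d) ℝ (Space d) :=
  (LinearMap.BilinForm.dualBasis (innerₗ (Space d)) (innerₗ_nondegenerate d) γ).isUnitSMul
    (w := fun _ => 2 * Real.pi) (fun _ => (mul_ne_zero two_ne_zero Real.pi_ne_zero).isUnit)

lemma inner_dual {d : ℕ} (γ : Module.Basis (Fin d) ℝ (Space d)) (i j : Fin d) :
    inner ℝ (γ i) (dual γ j) = if i = j then 2 * Real.pi else 0 := by
  have h := LinearMap.BilinForm.apply_dualBasis_left (innerₗ_nondegenerate d) γ j i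
  rw [innerₗ_apply_apply] at h
  rw [dual, Module.Basis.isUnitSMul_apply, inner_smul_right, real_inner_comm, h]
  split_ifs <;> simp

/-- The fibre space `H_f = L²(𝕋^d)`, the torus `ℝ^d/Γ` being represented by the cell `Y`. -/
abbrev FiberSpace {d : ℕ} (γ : Module.Basis (Fin d) ℝ (Space d)) : Type :=
  Lp ℂ 2 ((volume : Measure (Space d)).restrict (cell γ))

/-- The normalized Lebesgue measure `|Y*|⁻¹ dk` on the Brillouin zone `Y*`. -/
def brillouinMeasure {d : ℕ} (γ : Module.Basis (Fin d) ℝ (Space d)) : Measure (Space d) :=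
  ProbabilityTheory.cond volume (cell (dual γ))

instance {d : ℕ} (γ : Module.Basis (Fin d) ℝ (Space d)) :
    IsFiniteMeasure (brillouinMeasure γ) := by
  unfold brillouinMeasure; infer_instance

/-- `L²(Y*, |Y*|⁻¹ dk; H_f)`, that is `L²(Y*) ⊗ H_f`. -/
abbrev ZakSpace {d : ℕ} (γ : Module.Basis (Fin d) ℝ (Space d)) : Type :=
  Lp (FiberSpace γ) 2 (brillouinMeasure γ)

/-! ### The Bloch-Floquet-Zak transform -/

lemma norm_phase {d : ℕ} (k y : Space d) :
    ‖Complex.exp (Complex.I * ((-inner ℝ y k : ℝ) : ℂ))‖ = 1 :=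
  Complex.norm_exp_I_mul_ofReal _

lemma memLp_phase {d : ℕ} (γ : Module.Basis (Fin d) ℝ (Space d)) (k : Space d)
    (f : FiberSpace γ) :
    MemLp (fun y => Complex.exp (Complex.I * ((-inner ℝ y k : ℝ) : ℂ)) * f y) 2
      ((volume : Measure (Space d)).restrict (cell γ)) := by
  refine (Lp.memLp f).of_le (AEStronglyMeasurable.mul ?_ (Lp.aestronglyMeasurable f)) ?_
  · exact Continuous.aestronglyMeasurable (by fun_prop)
  · filter_upwards with y
    rw [norm_mul, norm_phase, one_mul]

/-- Multiplication by `y ↦ exp(-i y·k)` on `H_f`. -/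
def phase {d : ℕ} (γ : Module.Basis (Fin d) ℝ (Space d)) (k : Space d) (f : FiberSpace γ) :
    FiberSpace γ :=
  (memLp_phase γ k f).toLp _

/-- `ψ ↦ ψ(· + a)` restricted to the cell `Y`. -/
def shiftRestrict {d : ℕ} (γ : Module.Basis (Fin d) ℝ (Space d)) (a : Space d) (ψ : L2 d) :
    FiberSpace γ :=
  LpToLpRestrictCLM (Space d) ℂ ℂ volume 2 (cell γ)
    (Lp.compMeasurePreserving (fun y => y + a) (measurePreserving_add_right volume a) ψ)

/-- The function `y ↦ exp(-i (y + a)·k) ψ(y + a)` in `H_f`. -/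
def zakSection {d : ℕ} (γ : Module.Basis (Fin d) ℝ (Space d)) (a : Space d) (ψ : L2 d)
    (k : Space d) : FiberSpace γ :=
  Complex.exp (Complex.I * ((-inner ℝ a k : ℝ) : ℂ)) • phase γ k (shiftRestrict γ a ψ)

lemma norm_phase_apply_le {d : ℕ} (γ : Module.Basis (Fin d) ℝ (Space d)) (k : Space d)
    (f : FiberSpace γ) : ‖phase γ k f‖ ≤ 1 * ‖f‖ := by
  refine Lp.norm_le_mul_norm_of_ae_le_mul ?_
  filter_upwards [(memLp_phase γ k f).coeFn_toLp] with y hy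
  rw [phase, hy, norm_mul, norm_phase]

lemma norm_le_of_mem_cell {d : ℕ} (γ : Module.Basis (Fin d) ℝ (Space d)) {y : Space d}
    (hy : y ∈ cell γ) : ‖y‖ ≤ ∑ l, ‖γ l‖ := by
  conv_lhs => rw [← γ.sum_repr y]
  refine (norm_sum_le _ _).trans (Finset.sum_le_sum fun l _ => ?_)
  rw [norm_smul]
  have h1 : ‖γ.repr y l‖ ≤ 1 := by
    rw [Real.norm_eq_abs, abs_le]
    exact ⟨by linarith [(hy l).1], by linarith [(hy l).2]⟩
  exact mul_le_of_le_one_left (norm_nonneg _) h1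

lemma measurableSet_cell {d : ℕ} (γ : Module.Basis (Fin d) ℝ (Space d)) :
    MeasurableSet (cell γ) := by
  have h : cell γ = ⋂ l, (fun x => γ.equivFunL x l) ⁻¹' Set.Icc (-(1 / 2) : ℝ) (1 / 2) := by
    ext x
    simp [cell]
  rw [h]
  refine MeasurableSet.iInter fun l => ?_
  exact measurableSet_Icc.preimage
    (((continuous_apply l).comp γ.equivFunL.continuous).measurable)

lemma norm_phase_sub_le {d : ℕ} (γ : Module.Basis (Fin d) ℝ (Space d)) (k k' : Space d)
    (f : FiberSpace γ) :
    ‖phase γ k f - phase γ k' f‖ ≤ ((∑ l, ‖γ l‖) * ‖k - k'‖) * ‖f‖ := by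
  refine Lp.norm_le_mul_norm_of_ae_le_mul ?_
  filter_upwards [(memLp_phase γ k f).coeFn_toLp, (memLp_phase γ k' f).coeFn_toLp,
    Lp.coeFn_sub (phase γ k f) (phase γ k' f),
    ae_restrict_mem (measurableSet_cell γ)] with y h1 h2 h3 hy
  rw [h3, Pi.sub_apply, phase, phase, h1, h2, ← sub_mul, norm_mul]
  refine mul_le_mul_of_nonneg_right ?_ (norm_nonneg _)
  have h4 : Complex.exp (Complex.I * ((-inner ℝ y k : ℝ) : ℂ)) -
      Complex.exp (Complex.I * ((-inner ℝ y k' : ℝ) : ℂ)) =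
      Complex.exp (Complex.I * ((-inner ℝ y k' : ℝ) : ℂ)) *
        (Complex.exp (Complex.I * ((-inner ℝ y (k - k') : ℝ) : ℂ)) - 1) := by
    rw [mul_sub, ← Complex.exp_add, mul_one, inner_sub_right]
    congr 2
    push_cast
    ring
  rw [h4, norm_mul, norm_phase, one_mul]
  refine Real.norm_exp_I_mul_ofReal_sub_one_le.trans ?_
  rw [norm_neg]
  exact (norm_inner_le_norm y (k - k')).trans
    (mul_le_mul_of_nonneg_right (norm_le_of_mem_cell γ hy) (norm_nonneg _))

lemma continuous_phase {d : ℕ} (γ : Module.Basis (Fin d) ℝ (Space d)) (f : FiberSpace γ) :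
    Continuous fun k => phase γ k f := by
  refine LipschitzWith.continuous (K := Real.toNNReal ((∑ l, ‖γ l‖) * ‖f‖)) ?_
  refine LipschitzWith.of_dist_le_mul fun k k' => ?_
  rw [dist_eq_norm, dist_eq_norm, Real.coe_toNNReal _ (by positivity)]
  refine (norm_phase_sub_le γ k k' f).trans (le_of_eq ?_)
  ring

lemma memLp_zakSection {d : ℕ} (γ : Module.Basis (Fin d) ℝ (Space d)) (a : Space d)
    (ψ : L2 d) : MemLp (zakSection γ a ψ) 2 (brillouinMeasure γ) := by
  refine MemLp.of_bound (Continuous.aestronglyMeasurable ?_) ‖shiftRestrict γ a ψ‖ ?_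
  · unfold zakSection
    have h1 : Continuous fun k : Space d =>
        Complex.exp (Complex.I * ((-inner ℝ a k : ℝ) : ℂ)) := by fun_prop
    exact h1.smul (continuous_phase γ _)
  · filter_upwards with k
    rw [zakSection, norm_smul, norm_phase, one_mul]
    simpa using norm_phase_apply_le γ k (shiftRestrict γ a ψ)

/-- The Bloch-Floquet-Zak transform
`(𝒵ψ)(k,y) = ∑_{a ∈ Γ} exp(-i (y + a)·k) ψ(y + a)`. The terms are pairwise orthogonal in
`L²(Y*; H_f)` with square norms summing to `‖ψ‖²`, and the series converges in that space. -/
def zak {d : ℕ} (γ : Module.Basis (Fin d) ℝ (Space d)) (ψ : L2 d) : ZakSpace γ :=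
  ∑' a : lattice γ, (memLp_zakSection γ (a : Space d) ψ).toLp _

/-! ### Unbounded operators -/

section Operators

variable {𝓗 : Type} [NormedAddCommGroup 𝓗] [InnerProductSpace ℂ 𝓗]

/-- `R = (A - z)⁻¹` as a bounded everywhere defined operator. -/
def IsResolvent (A : 𝓗 →ₗ.[ℂ] 𝓗) (z : ℂ) (R : 𝓗 →L[ℂ] 𝓗) : Prop :=
  (∀ f, (R f, f + z • R f) ∈ A.graph) ∧ ∀ f g, (f, g) ∈ A.graph → R (g - z • f) = f

/-- The spectrum of an unbounded operator: complement of the resolvent set. -/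
def pspectrum (A : 𝓗 →ₗ.[ℂ] 𝓗) : Set ℂ := {z | ¬ ∃ R : 𝓗 →L[ℂ] 𝓗, IsResolvent A z R}

/-- The eigenspace of an unbounded operator. -/
def eigenspace (A : 𝓗 →ₗ.[ℂ] 𝓗) (z : ℂ) : Submodule ℂ 𝓗 where
  carrier := {f | (f, z • f) ∈ A.graph}
  add_mem' {f g} hf hg := by
    have h := A.graph.add_mem hf hg
    rwa [Prod.mk_add_mk, ← smul_add] at h
  zero_mem' := by
    change ((0 : 𝓗), z • (0 : 𝓗)) ∈ A.graph
    rw [smul_zero]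
    exact A.graph.zero_mem
  smul_mem' c f hf := by
    have h := A.graph.smul_mem c hf
    rwa [Prod.smul_mk, smul_comm] at h

/-- The orthogonal projection onto an eigenspace (closed already if `A` is self-adjoint). -/
def eigenprojection [CompleteSpace 𝓗] (A : 𝓗 →ₗ.[ℂ] 𝓗) (z : ℂ) : 𝓗 →L[ℂ] 𝓗 :=
  (eigenspace A z).topologicalClosure.starProjection

/-- A projection-valued measure on the Borel sets of `ℝ`. -/
structure ProjMeasure (𝓗 : Type) [NormedAddCommGroup 𝓗] [InnerProductSpace ℂ 𝓗]
    [CompleteSpace 𝓗] where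
  /-- the projection attached to a Borel set -/
  proj : Set ℝ → 𝓗 →L[ℂ] 𝓗
  isStarProjection : ∀ S, MeasurableSet S → IsStarProjection (proj S)
  proj_univ : proj Set.univ = 1
  proj_inter : ∀ S T, MeasurableSet S → MeasurableSet T → proj (S ∩ T) = proj S * proj T
  hasSum_proj : ∀ S : ℕ → Set ℝ, (∀ n, MeasurableSet (S n)) →
    Pairwise (Function.onFun Disjoint S) →
    ∀ f, HasSum (fun n => proj (S n) f) (proj (⋃ n, S n) f)

/-- `A = ∫ λ dΠ(λ)`: with `μ_f = ⟨f, Π(·) f⟩`, the domain of `A` consists of the `f` with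
`∫ λ² dμ_f < ∞`, and `⟨f, A f⟩ = ∫ λ dμ_f` there. -/
def ProjMeasure.Represents [CompleteSpace 𝓗] (Q : ProjMeasure 𝓗) (A : 𝓗 →ₗ.[ℂ] 𝓗) : Prop :=
  ∀ f : 𝓗, ∃ μ : Measure ℝ,
    (∀ S, MeasurableSet S → μ S = ENNReal.ofReal (‖Q.proj S f‖ ^ 2)) ∧
    (f ∈ A.domain ↔ Integrable (fun x : ℝ => x ^ 2) μ) ∧
    ∀ g, (f, g) ∈ A.graph → inner ℂ f g = ((∫ x, x ∂μ : ℝ) : ℂ)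

/-- `B = 𝟏_S(A)` for self-adjoint `A`: the value on `S` of the spectral measure of `A`. -/
def IsSpectralProjection [CompleteSpace 𝓗] (A : 𝓗 →ₗ.[ℂ] 𝓗) (S : Set ℝ) (B : 𝓗 →L[ℂ] 𝓗) :
    Prop :=
  ∃ Q : ProjMeasure 𝓗, Q.Represents A ∧ B = Q.proj S

/-- `e 0 ≤ e 1 ≤ …` are the eigenvalues of `A`, repeated according to multiplicity, and there is
an orthonormal basis of corresponding eigenvectors. -/
def IsEigenvalueEnumeration (A : 𝓗 →ₗ.[ℂ] 𝓗) (e : ℕ → ℝ) : Prop :=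
  Monotone e ∧ ∃ φ : HilbertBasis ℕ ℂ 𝓗, ∀ n, (φ n, (e n : ℂ) • φ n) ∈ A.graph

/-- `A` is trace class with trace `z`: for every orthonormal basis the diagonal series converges
unconditionally to `z`. -/
def HasTrace (A : 𝓗 →L[ℂ] 𝓗) (z : ℂ) : Prop :=
  ∀ (ι : Type) (b : HilbertBasis ι ℂ 𝓗), HasSum (fun i => inner ℂ (b i) (A (b i))) z

/-- Trace class operators. -/
def IsTraceClass (A : 𝓗 →L[ℂ] 𝓗) : Prop := ∃ z, HasTrace A z

open Classical in
/-- The trace of a trace class operator. -/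
def trace (A : 𝓗 →L[ℂ] 𝓗) : ℂ := if h : IsTraceClass A then h.choose else 0

end Operators

/-! ### Fibered operators and the projectors -/

/-- `A` commutes with complex conjugation `ψ ↦ ψ̄` on `L²(ℝ^d)`. -/
def CommutesWithConj {d : ℕ} (A : L2 d →ₗ.[ℂ] L2 d) : Prop :=
  ∀ ψ χ, (ψ, χ) ∈ A.graph → (star ψ, star χ) ∈ A.graph

/-- `𝒵 A 𝒵⁻¹ = ∫^⊕_{Y*} h(k) dk` as unbounded operators: the graph of `𝒵 A 𝒵⁻¹` consists of the
pairs `(Φ, Ξ)` in `L²(Y*; H_f)` with `Φ(k)` in the domain of `h(k)` and `h(k) Φ(k) = Ξ(k)` for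
almost every `k`. -/
def IsFiberDecomposition {d : ℕ} (γ : Module.Basis (Fin d) ℝ (Space d)) (A : L2 d →ₗ.[ℂ] L2 d)
    (h : Space d → FiberSpace γ →ₗ.[ℂ] FiberSpace γ) : Prop :=
  (fun p : L2 d × L2 d => (zak γ p.1, zak γ p.2)) '' (A.graph : Set (L2 d × L2 d)) =
    {p : ZakSpace γ × ZakSpace γ | ∀ᵐ k ∂(brillouinMeasure γ), (p.1 k, p.2 k) ∈ (h k).graph}

/-- `𝒵 A 𝒵⁻¹` is continuously fibered, with self-adjoint fibres `h(k)`, `k ∈ ℝ^d`, that are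
continuous in the (strong) resolvent sense and equivariant,
`h(k + κ) = exp(-i y·κ) h(k) exp(i y·κ)` for `κ` in the dual lattice. -/
structure IsContinuouslyFibered {d : ℕ} (γ : Module.Basis (Fin d) ℝ (Space d))
    (A : L2 d →ₗ.[ℂ] L2 d) (h : Space d → FiberSpace γ →ₗ.[ℂ] FiberSpace γ) : Prop where
  decomposition : IsFiberDecomposition γ A h
  selfAdjoint : ∀ k, IsSelfAdjoint (h k)
  continuous : ∃ R : Space d → FiberSpace γ →L[ℂ] FiberSpace γ,
    (∀ k, IsResolvent (h k) Complex.I (R k)) ∧ ∀ f, Continuous fun k => R k f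
  equivariant : ∀ k, ∀ κ ∈ lattice (dual γ), ∀ f g, (f, g) ∈ (h k).graph →
    (phase γ κ f, phase γ κ g) ∈ (h (k + κ)).graph

/-- Case (a): `E(t)` is in the resolvent set of `H(t)` and
`P(k,t) = 𝟏_{(-∞,E(t))}(H(k,t))` for all `k` and all `t ∈ I`. -/
def IsFermiProjector {d : ℕ} (γ : Module.Basis (Fin d) ℝ (Space d)) (I : Set ℝ)
    (H : ℝ → L2 d →ₗ.[ℂ] L2 d) (h : Space d → ℝ → FiberSpace γ →ₗ.[ℂ] FiberSpace γ)
    (P : Space d → ℝ → FiberSpace γ →L[ℂ] FiberSpace γ) : Prop :=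
  ∃ E : ℝ → ℝ, ∀ t ∈ I, (E t : ℂ) ∉ pspectrum (H t) ∧
    ∀ k, IsSpectralProjection (h k t) (Set.Iio (E t)) (P k t)

/-- Case (b): `P(k,t)` is the eigenprojector of the `m`-th Bloch band `E_m(k,t)`, which is
isolated: it keeps a positive distance, uniform in `k`, to the rest of the spectrum. -/
def IsBlochProjector {d : ℕ} (γ : Module.Basis (Fin d) ℝ (Space d)) (I : Set ℝ)
    (h : Space d → ℝ → FiberSpace γ →ₗ.[ℂ] FiberSpace γ)
    (P : Space d → ℝ → FiberSpace γ →L[ℂ] FiberSpace γ) : Prop :=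
  ∃ (e : Space d → ℝ → ℕ → ℝ) (m : ℕ), ∀ t ∈ I,
    (∀ k, IsEigenvalueEnumeration (h k t) (e k t)) ∧
    (∃ g > 0, ∀ k, ∀ z ∈ pspectrum (h k t), z ≠ (e k t m : ℂ) → g ≤ ‖z - (e k t m : ℂ)‖) ∧
    ∀ k, P k t = eigenprojection (h k t) (e k t m : ℂ)

/-! ### The piezocurvature -/

/-- `∂P/∂k_j`. -/
def dk {d : ℕ} {γ : Module.Basis (Fin d) ℝ (Space d)}
    (P : Space d → ℝ → FiberSpace γ →L[ℂ] FiberSpace γ) (j : Fin d) (k : Space d) (t : ℝ) :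
    FiberSpace γ →L[ℂ] FiberSpace γ :=
  fderiv ℝ (fun q => P q t) k (EuclideanSpace.single j 1)

/-- `∂P/∂t`, for `t` in the time interval `I`. -/
def dt {d : ℕ} {γ : Module.Basis (Fin d) ℝ (Space d)} (I : Set ℝ)
    (P : Space d → ℝ → FiberSpace γ →L[ℂ] FiberSpace γ) (k : Space d) (t : ℝ) :
    FiberSpace γ →L[ℂ] FiberSpace γ :=
  derivWithin (fun s => P k s) I t

/-- The operator `P [∂_t P, ∂_j P]`. -/
def curvatureOp {d : ℕ} {γ : Module.Basis (Fin d) ℝ (Space d)} (I : Set ℝ)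
    (P : Space d → ℝ → FiberSpace γ →L[ℂ] FiberSpace γ) (j : Fin d) (k : Space d) (t : ℝ) :
    FiberSpace γ →L[ℂ] FiberSpace γ :=
  P k t * (dt I P k t * dk P j k t - dk P j k t * dt I P k t)

/-- The piezocurvature `Θ = -i tr(P [∂_t P, ∇_k P])`, a vector with `d` components. -/
def piezocurvature {d : ℕ} {γ : Module.Basis (Fin d) ℝ (Space d)} (I : Set ℝ)
    (P : Space d → ℝ → FiberSpace γ →L[ℂ] FiberSpace γ) (k : Space d) (t : ℝ) : Fin d → ℂ :=
  fun j => -Complex.I * trace (curvatureOp I P j k t)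

/-- The derivatives and the traces in the definition of `Θ(k,t)` exist. -/
structure PiezocurvatureExists {d : ℕ} {γ : Module.Basis (Fin d) ℝ (Space d)} (I : Set ℝ)
    (P : Space d → ℝ → FiberSpace γ →L[ℂ] FiberSpace γ) (k : Space d) (t : ℝ) : Prop where
  differentiable_k : DifferentiableAt ℝ (fun q => P q t) k
  differentiable_t : DifferentiableWithinAt ℝ (fun s => P k s) I t
  traceClass : ∀ j, IsTraceClass (curvatureOp I P j k t)

end Piezo

end

noncomputable section

namespace Piezo

section Operators

variable {𝓗 : Type} [NormedAddCommGroup 𝓗] [InnerProductSpace ℂ 𝓗] [CompleteSpace 𝓗]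

/-! ### Self-adjoint operators through their graphs -/

/-! Write `C` for complex conjugation. The Zak transform turns it into the reflection `Φ ↦ C Φ(-·)`
(`zak_star`), so since `H(t)` is real, the graph of its fibered form is invariant under this
reflection. Applied to the sections `k ↦ R(k) g`, with `R(k)` the resolvent of the fibre at `i`,
this gives for almost every `k` a weak form of `C R(-k) C = R(k)*`. Both sides are continuous in
`k`, so it holds on the whole cell; self-adjointness turns it into a statement about graphs and
equivariance carries it to every `k`. Hence `h(k) = C h(-k) C`
(`IsContinuouslyFibered.star_mem_graph_iff`).

The projectors inherit the symmetry because they are determined by the fibre operator. In case (a)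
this is uniqueness of the spectral measure (`ProjMeasure.Represents.unique`), proved from domains
and quadratic forms alone by comparing the growth of `(A - c)^n f` on spectral subspaces of two
measures. In case (b) it is uniqueness of the ordered eigenvalues, a dimension count.

For the curvature, conjugation by `C` leaves `∂_t P` even in `k` and makes `∂_k P` odd, so `T = P
[∂_t P, ∂_j P]` satisfies `T(-k) = -C T(k) C`. Derivatives of projections are off-diagonal, whence
`T* = -T` and `T(-k) = C T(k)* C`. Passing to the adjoint and conjugating by `C` each conjugate the
trace, so the two effects cancel. -/

lemma mem_graph_iff_of_isSelfAdjoint {A : 𝓗 →ₗ.[ℂ] 𝓗} (hA : IsSelfAdjoint A) {f g : 𝓗} :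
    (f, g) ∈ A.graph ↔ ∀ x y, (x, y) ∈ A.graph → inner ℂ y f = inner ℂ x g := by
  have h := LinearPMap.adjoint_graph_eq_graph_adjoint hA.dense_domain
  rw [LinearPMap.isSelfAdjoint_def.mp hA] at h
  conv_lhs => rw [h]
  rw [Submodule.mem_adjoint_iff]
  simp only [sub_eq_zero]

lemma inner_comm_of_mem_graph {A : 𝓗 →ₗ.[ℂ] 𝓗} (hA : IsSelfAdjoint A) {f g x y : 𝓗}
    (hf : (f, g) ∈ A.graph) (hx : (x, y) ∈ A.graph) : inner ℂ y f = inner ℂ x g :=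
  (mem_graph_iff_of_isSelfAdjoint hA).mp hf x y hx

/-! ### Projection-valued measures -/

namespace ProjMeasure

variable (Q : ProjMeasure 𝓗)

/-- Countable additivity for the constant sequence `∅` makes a series of equal terms converge, so
the term is zero. -/
lemma proj_empty (f : 𝓗) : Q.proj ∅ f = 0 := by
  have h := (Q.hasSum_proj (fun _ => ∅) (fun _ => MeasurableSet.empty)
    (fun _ _ _ => disjoint_bot_left) f).summable
  exact tendsto_nhds_unique tendsto_const_nhds h.tendsto_atTop_zero

lemma proj_add_proj_compl {S : Set ℝ} (hS : MeasurableSet S) (f : 𝓗) :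
    Q.proj S f + Q.proj Sᶜ f = f := by
  have h := Q.hasSum_proj (fun n => if n = 0 then S else if n = 1 then Sᶜ else ∅)
    (fun n => by split_ifs <;> simp [hS]) ?_ f
  · have hU : (⋃ n : ℕ, if n = 0 then S else if n = 1 then Sᶜ else ∅) = Set.univ := by
      refine Set.eq_univ_of_forall fun x => Set.mem_iUnion.mpr ?_
      by_cases hx : x ∈ S
      · exact ⟨0, by simpa using hx⟩
      · exact ⟨1, by simpa using hx⟩
    rw [hU, Q.proj_univ] at h
    have h2 := hasSum_sum_of_ne_finset_zero (L := .unconditional ℕ) (s := Finset.range 2)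
      (f := fun n : ℕ => Q.proj (if n = 0 then S else if n = 1 then Sᶜ else ∅) f) fun n hn => by
        have : 1 < n := by simpa using hn
        rw [if_neg (by lia), if_neg (by lia), Q.proj_empty]
    have h3 := h2.unique h
    simpa [Finset.sum_range_succ] using h3
  · intro m n hmn
    simp only [Function.onFun]
    split_ifs <;> simp_all [disjoint_compl_right, disjoint_compl_left]

lemma proj_proj {S T : Set ℝ} (hS : MeasurableSet S) (hT : MeasurableSet T) (f : 𝓗) :
    Q.proj S (Q.proj T f) = Q.proj (S ∩ T) f := by
  rw [Q.proj_inter S T hS hT]; rfl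

lemma proj_idem {S : Set ℝ} (hS : MeasurableSet S) (f : 𝓗) :
    Q.proj S (Q.proj S f) = Q.proj S f := by
  rw [Q.proj_proj hS hS, Set.inter_self]

lemma proj_compl_eq_zero_iff {S : Set ℝ} (hS : MeasurableSet S) {f : 𝓗} :
    Q.proj Sᶜ f = 0 ↔ Q.proj S f = f := by
  have h := Q.proj_add_proj_compl hS f
  constructor
  · intro h0; rwa [h0, add_zero] at h
  · intro h0; rw [h0] at h; simpa using h

lemma proj_compl_eq_self_iff {S : Set ℝ} (hS : MeasurableSet S) {f : 𝓗} :
    Q.proj Sᶜ f = f ↔ Q.proj S f = 0 := by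
  rw [← Q.proj_compl_eq_zero_iff hS.compl, compl_compl]

lemma proj_eq_self_mono {S T : Set ℝ} (hS : MeasurableSet S) (hT : MeasurableSet T) (hST : S ⊆ T)
    {f : 𝓗} (hf : Q.proj S f = f) : Q.proj T f = f := by
  rw [← hf, Q.proj_proj hT hS, Set.inter_eq_right.mpr hST]

lemma inner_proj_left {S : Set ℝ} (hS : MeasurableSet S) (f g : 𝓗) :
    inner ℂ (Q.proj S f) g = inner ℂ f (Q.proj S g) :=
  ContinuousLinearMap.isSelfAdjoint_iff_isSymmetric.mp (Q.isStarProjection S hS).isSelfAdjoint f g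

lemma norm_proj_sq {S : Set ℝ} (hS : MeasurableSet S) (f : 𝓗) :
    inner ℂ (Q.proj S f) f = ((‖Q.proj S f‖ ^ 2 : ℝ) : ℂ) := by
  conv_lhs => rw [← Q.proj_idem hS, Q.inner_proj_left hS]
  rw [inner_self_eq_norm_sq_to_K]
  norm_cast

lemma norm_proj_le {S : Set ℝ} (hS : MeasurableSet S) (f : 𝓗) : ‖Q.proj S f‖ ≤ ‖f‖ := by
  have h := (Q.proj S).le_of_opNorm_le ((Q.isStarProjection S hS).norm_le (Q.proj S)) f
  simpa using h

/-- `μ` is the scalar spectral measure of `Q` at `f`. -/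
def IsScalarMeasure (f : 𝓗) (μ : Measure ℝ) : Prop :=
  ∀ S, MeasurableSet S → μ S = ENNReal.ofReal (‖Q.proj S f‖ ^ 2)

/-! ### Scalar spectral measures and reduction of a represented operator by spectral subspaces -/

variable {Q} {A : 𝓗 →ₗ.[ℂ] 𝓗}

lemma IsScalarMeasure.isFiniteMeasure {f : 𝓗} {μ : Measure ℝ} (h : Q.IsScalarMeasure f μ) :
    IsFiniteMeasure μ :=
  ⟨by rw [h _ MeasurableSet.univ]; exact ENNReal.ofReal_lt_top⟩

lemma IsScalarMeasure.real_univ {f : 𝓗} {μ : Measure ℝ} (h : Q.IsScalarMeasure f μ) :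
    μ.real Set.univ = ‖f‖ ^ 2 := by
  rw [measureReal_def, h _ MeasurableSet.univ, Q.proj_univ,
    ENNReal.toReal_ofReal (by positivity)]
  rfl

lemma IsScalarMeasure.eq_restrict {f : 𝓗} {S : Set ℝ} {μ ν : Measure ℝ}
    (h : Q.IsScalarMeasure f μ) (hS : MeasurableSet S)
    (h' : Q.IsScalarMeasure (Q.proj S f) ν) : ν = μ.restrict S := by
  ext T hT
  rw [h' T hT, Measure.restrict_apply hT, h _ (hT.inter hS), Q.proj_proj hT hS]

lemma IsScalarMeasure.ae_mem {f : 𝓗} {S : Set ℝ} {μ : Measure ℝ} (h : Q.IsScalarMeasure f μ)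
    (hS : MeasurableSet S) (hf : Q.proj S f = f) : ∀ᵐ x ∂μ, x ∈ S := by
  rw [ae_iff]
  change μ Sᶜ = 0
  rw [h _ hS.compl, (Q.proj_compl_eq_zero_iff hS).mpr hf]
  simp

lemma integrable_id_of_integrable_sq {μ : Measure ℝ} [IsFiniteMeasure μ]
    (h : Integrable (fun x : ℝ => x ^ 2) μ) : Integrable (fun x : ℝ => x) μ := by
  refine ((integrable_const (1 : ℝ)).add h).mono' measurable_id.aestronglyMeasurable ?_
  filter_upwards with x
  simp only [Pi.add_apply, Real.norm_eq_abs]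
  rw [abs_le]
  constructor <;> nlinarith [sq_nonneg (x - 1), sq_nonneg (x + 1)]

lemma Represents.exists_integral (hQ : Q.Represents A) {f g : 𝓗} (hfg : (f, g) ∈ A.graph) :
    ∃ μ, IsFiniteMeasure μ ∧ Q.IsScalarMeasure f μ ∧ Integrable (fun x : ℝ => x) μ ∧
      inner ℂ f g = ((∫ x, x ∂μ : ℝ) : ℂ) := by
  obtain ⟨μ, h1, h2, h3⟩ := hQ f
  have hfin : IsFiniteMeasure μ := IsScalarMeasure.isFiniteMeasure h1
  exact ⟨μ, hfin, h1, integrable_id_of_integrable_sq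
    (h2.mp (LinearPMap.mem_domain_iff.mpr ⟨g, hfg⟩)), h3 g hfg⟩

lemma Represents.proj_mem_domain (hQ : Q.Represents A) {S : Set ℝ} (hS : MeasurableSet S) {f : 𝓗}
    (hf : f ∈ A.domain) : Q.proj S f ∈ A.domain := by
  obtain ⟨μ, h1, h2, -⟩ := hQ f
  obtain ⟨ν, h1', h2', -⟩ := hQ (Q.proj S f)
  rw [h2', IsScalarMeasure.eq_restrict h1 hS h1']
  exact (h2.mp hf).integrableOn

lemma Represents.mem_domain_of_bounded (hQ : Q.Represents A) {a b : ℝ} {f : 𝓗}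
    (hf : Q.proj (Set.Icc a b) f = f) : f ∈ A.domain := by
  obtain ⟨μ, h1, h2, -⟩ := hQ f
  have hfin : IsFiniteMeasure μ := IsScalarMeasure.isFiniteMeasure h1
  rw [h2]
  refine (integrable_const (a ^ 2 + b ^ 2)).mono'
    (measurable_id.pow_const 2).aestronglyMeasurable ?_
  filter_upwards [IsScalarMeasure.ae_mem h1 measurableSet_Icc hf] with x hx
  rw [Real.norm_eq_abs, abs_of_nonneg (by simpa using sq_nonneg x)]
  rcases le_total 0 x with h0 | h0
  · nlinarith [hx.2, sq_nonneg a]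
  · nlinarith [hx.1, sq_nonneg b]

lemma Represents.le_re_inner (hQ : Q.Represents A) {S : Set ℝ} (hS : MeasurableSet S) {a : ℝ}
    (ha : ∀ x ∈ S, a ≤ x) {f g : 𝓗} (hf : Q.proj S f = f) (hfg : (f, g) ∈ A.graph) :
    a * ‖f‖ ^ 2 ≤ (inner ℂ f g).re := by
  obtain ⟨μ, hfin, h1, h2, h3⟩ := hQ.exists_integral hfg
  rw [h3, Complex.ofReal_re, ← h1.real_univ, mul_comm, ← smul_eq_mul, ← integral_const]
  refine integral_mono_ae (integrable_const _) h2 ?_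
  filter_upwards [h1.ae_mem hS hf] with x hx using ha x hx

lemma Represents.re_inner_le (hQ : Q.Represents A) {S : Set ℝ} (hS : MeasurableSet S) {a : ℝ}
    (ha : ∀ x ∈ S, x ≤ a) {f g : 𝓗} (hf : Q.proj S f = f) (hfg : (f, g) ∈ A.graph) :
    (inner ℂ f g).re ≤ a * ‖f‖ ^ 2 := by
  obtain ⟨μ, hfin, h1, h2, h3⟩ := hQ.exists_integral hfg
  rw [h3, Complex.ofReal_re, ← h1.real_univ, mul_comm, ← smul_eq_mul, ← integral_const]
  refine integral_mono_ae h2 (integrable_const _) ?_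
  filter_upwards [h1.ae_mem hS hf] with x hx using ha x hx

/-- The scalar measure of `f + g` restricts to that of `f` on `S` and to that of `g` on `Sᶜ`. The
quadratic form is therefore additive on `f + g`, and the cross terms cancel. -/
lemma Represents.inner_add_inner_eq_zero (hQ : Q.Represents A) {S : Set ℝ} (hS : MeasurableSet S)
    {f f' g g' : 𝓗} (hf : Q.proj S f = f) (hg : Q.proj S g = 0) (hff' : (f, f') ∈ A.graph)
    (hgg' : (g, g') ∈ A.graph) : inner ℂ f g' + inner ℂ g f' = 0 := by
  obtain ⟨μ, hfin, h1, h2, h3⟩ := hQ.exists_integral (A.graph.add_mem hff' hgg')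
  obtain ⟨ν, hfin', h1', h2', h3'⟩ := hQ.exists_integral hff'
  obtain ⟨ξ, hfin'', h1'', h2'', h3''⟩ := hQ.exists_integral hgg'
  have e1 : Q.proj S (f + g) = f := by rw [map_add, hf, hg, add_zero]
  have e2 : Q.proj Sᶜ (f + g) = g := by
    rw [map_add, (Q.proj_compl_eq_zero_iff hS).mpr hf, (Q.proj_compl_eq_self_iff hS).mpr hg,
      zero_add]
  have i1 := h1.eq_restrict hS (e1.symm ▸ h1')
  have i2 := h1.eq_restrict hS.compl (e2.symm ▸ h1'')
  have i3 := integral_add_compl hS h2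
  rw [← i1, ← i2] at i3
  change inner ℂ (f + g) (f' + g') = _ at h3
  rw [← i3, inner_add_left, inner_add_right, inner_add_right, h3', h3''] at h3
  push_cast at h3
  linear_combination h3

lemma Represents.inner_eq_zero (hQ : Q.Represents A) {S : Set ℝ} (hS : MeasurableSet S)
    {f f' g g' : 𝓗} (hf : Q.proj S f = f) (hg : Q.proj S g = 0) (hff' : (f, f') ∈ A.graph)
    (hgg' : (g, g') ∈ A.graph) : inner ℂ g f' = 0 := by
  have h1 := hQ.inner_add_inner_eq_zero hS hf hg hff' hgg'
  -- Replacing `f` by `i f` changes the relative sign of the two cross terms, so that each vanishes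
  -- separately.
  have h2 := hQ.inner_add_inner_eq_zero hS (f := Complex.I • f) (by rw [map_smul, hf]) hg
    (A.graph.smul_mem Complex.I hff') hgg'
  rw [inner_smul_left, inner_smul_right, Complex.conj_I] at h2
  have h3 : (2 * Complex.I) * inner ℂ g f' = 0 := by linear_combination h2 + Complex.I * h1
  simpa using h3

/-- By the preceding orthogonality, `g = A f` is orthogonal to `u - Q(S) u` for every `u` in the
dense domain. -/
lemma Represents.proj_apply_eq_self (hQ : Q.Represents A) (hA : Dense (A.domain : Set 𝓗))
    {S : Set ℝ} (hS : MeasurableSet S) {f g : 𝓗} (hf : Q.proj S f = f)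
    (hfg : (f, g) ∈ A.graph) : Q.proj S g = g := by
  refine hA.eq_of_inner_right ℂ fun u hu => ?_
  have hu' := hQ.proj_mem_domain hS hu
  obtain ⟨v, hv⟩ := LinearPMap.mem_domain_iff.mp (A.domain.sub_mem hu hu')
  have h := hQ.inner_eq_zero hS hf (by rw [map_sub, Q.proj_idem hS, sub_self]) hfg hv
  rw [inner_sub_left, Q.inner_proj_left hS] at h
  exact (sub_eq_zero.mp h).symm

lemma Represents.proj_mem_graph (hQ : Q.Represents A) (hA : Dense (A.domain : Set 𝓗))
    {S : Set ℝ} (hS : MeasurableSet S) {f g : 𝓗} (hfg : (f, g) ∈ A.graph) :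
    (Q.proj S f, Q.proj S g) ∈ A.graph := by
  obtain ⟨g₁, hg₁⟩ := LinearPMap.mem_domain_iff.mp
    (hQ.proj_mem_domain hS (LinearPMap.mem_domain_iff.mpr ⟨g, hfg⟩))
  have h1 := hQ.proj_apply_eq_self hA hS (Q.proj_idem hS f) hg₁
  have h2 := hQ.proj_apply_eq_self hA hS.compl
    ((Q.proj_compl_eq_self_iff hS).mpr (by rw [map_sub, Q.proj_idem hS, sub_self]))
    (A.graph.sub_mem hfg hg₁)
  rw [Q.proj_compl_eq_self_iff hS, map_sub, h1, sub_eq_zero] at h2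
  rwa [h2]

/-! ### Uniqueness of the spectral measure -/

lemma Represents.norm_sub_smul_le (hQ : Q.Represents A) (hA : IsSelfAdjoint A) {c r : ℝ}
    (hr : 0 < r) {f g : 𝓗} (hf : Q.proj (Set.Icc (c - r) (c + r)) f = f)
    (hfg : (f, g) ∈ A.graph) : ‖g - (c : ℂ) • f‖ ≤ r * ‖f‖ := by
  have hg := hQ.proj_apply_eq_self hA.dense_domain measurableSet_Icc hf hfg
  set b := g - (c : ℂ) • f with hb
  have hbK : Q.proj (Set.Icc (c - r) (c + r)) b = b := by rw [hb, map_sub, map_smul, hf, hg]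
  obtain ⟨b', hb'⟩ := LinearPMap.mem_domain_iff.mp (hQ.mem_domain_of_bounded hbK)
  -- the quadratic form of `A - c` at `f + s b`
  have key (s : ℝ) : |(inner ℂ (f + (s : ℂ) • b) (b + (s : ℂ) • (b' - (c : ℂ) • b))).re| ≤
      r * ‖f + (s : ℂ) • b‖ ^ 2 := by
    have hu : Q.proj (Set.Icc (c - r) (c + r)) (f + (s : ℂ) • b) = f + (s : ℂ) • b := by
      rw [map_add, map_smul, hf, hbK]
    have hm := A.graph.add_mem hfg (A.graph.smul_mem (s : ℂ) hb')
    have l1 := hQ.le_re_inner measurableSet_Icc (a := c - r) (fun x hx => hx.1) hu hm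
    have l2 := hQ.re_inner_le measurableSet_Icc (a := c + r) (fun x hx => hx.2) hu hm
    have e : b + (s : ℂ) • (b' - (c : ℂ) • b) =
        (g + (s : ℂ) • b') - (c : ℂ) • (f + (s : ℂ) • b) := by
      rw [hb]; module
    rw [e, inner_sub_right, inner_smul_right, inner_self_eq_norm_sq_to_K, Complex.sub_re]
    have e2 : ((c : ℂ) * ((‖f + (s : ℂ) • b‖ : ℂ)) ^ 2).re = c * ‖f + (s : ℂ) • b‖ ^ 2 := by
      norm_cast
    change |_ - ((c : ℂ) * ((‖f + (s : ℂ) • b‖ : ℂ)) ^ 2).re| ≤ _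
    rw [e2, abs_le]
    change _ ≤ (inner ℂ _ (g + (s : ℂ) • b')).re at l1
    change (inner ℂ _ (g + (s : ℂ) • b')).re ≤ _ at l2
    constructor <;> linarith
  -- Polarization: the difference of the forms at `f ± s b` is `4 s ‖b‖²` by symmetry of `A`. The
  -- choice `s = 1/r` balances `‖f‖²` against `s² ‖b‖²` in the parallelogram law and gives the sharp
  -- constant.
  have k1 := (abs_le.mp (key r⁻¹)).2
  have k2 := (abs_le.mp (key (-r⁻¹))).1
  have sym : (inner ℂ f (b' - (c : ℂ) • b)).re = ‖b‖ ^ 2 := by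
    have h1 := inner_comm_of_mem_graph hA hb' hfg
    have h2 : inner ℂ f (b' - (c : ℂ) • b) = inner ℂ b b := by
      conv_rhs => rw [hb, inner_sub_left, ← hb, h1, inner_smul_left, Complex.conj_ofReal]
      rw [inner_sub_right, inner_smul_right]
    rw [h2, inner_self_eq_norm_sq_to_K]
    norm_cast
  have hbb : (inner ℂ b b).re = ‖b‖ ^ 2 := by
    rw [inner_self_eq_norm_sq_to_K]; norm_cast
  have n1 : ‖f + ((r⁻¹ : ℝ) : ℂ) • b‖ ^ 2 + ‖f + ((-r⁻¹ : ℝ) : ℂ) • b‖ ^ 2 =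
      2 * (‖f‖ ^ 2 + r⁻¹ ^ 2 * ‖b‖ ^ 2) := by
    have := parallelogram_law_with_norm ℂ f (((r⁻¹ : ℝ) : ℂ) • b)
    rw [norm_smul, Complex.norm_real, Real.norm_of_nonneg (inv_nonneg.mpr hr.le)] at this
    rw [Complex.ofReal_neg, neg_smul, ← sub_eq_add_neg]
    nlinarith [this]
  simp only [inner_add_left, inner_add_right, inner_smul_left, inner_smul_right, Complex.add_re,
    Complex.conj_ofReal, Complex.re_ofReal_mul, sym, hbb] at k1 k2
  have k3 : 4 * r⁻¹ * ‖b‖ ^ 2 ≤ r * (2 * (‖f‖ ^ 2 + r⁻¹ ^ 2 * ‖b‖ ^ 2)) := by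
    rw [← n1]; nlinarith [k1, k2]
  have k4 : ‖b‖ ^ 2 ≤ (r * ‖f‖) ^ 2 := by
    have := mul_le_mul_of_nonneg_left k3 hr.le
    field_simp at this
    nlinarith [this]
  exact (sq_le_sq₀ (norm_nonneg _) (by positivity)).mp k4

lemma Represents.le_norm_sub_smul (hQ : Q.Represents A) (hA : IsSelfAdjoint A) {c ρ : ℝ}
    {f g : 𝓗} (hf : Q.proj (Set.Iic (c - ρ) ∪ Set.Ici (c + ρ)) f = f)
    (hρ : 0 < ρ) (hfg : (f, g) ∈ A.graph) : ρ * ‖f‖ ≤ ‖g - (c : ℂ) • f‖ := by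
  set p := Q.proj (Set.Ici (c + ρ)) f with hp
  set p' := Q.proj (Set.Ici (c + ρ)) g with hp'
  have hpm := hQ.proj_mem_graph hA.dense_domain (S := Set.Ici (c + ρ)) measurableSet_Ici hfg
  have hqm := A.graph.sub_mem hfg hpm
  have hpp : Q.proj (Set.Ici (c + ρ)) p = p := Q.proj_idem measurableSet_Ici f
  have hqp0 : Q.proj (Set.Ici (c + ρ)) (f - p) = 0 := by rw [map_sub, hpp, sub_self]
  have hqq : Q.proj (Set.Iic (c - ρ)) (f - p) = f - p := by
    have h1 : f - p = Q.proj (Set.Ici (c + ρ))ᶜ f := by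
      rw [sub_eq_iff_eq_add', hp, Q.proj_add_proj_compl measurableSet_Ici]
    have h2 : Q.proj (Set.Ici (c + ρ))ᶜ f = Q.proj (Set.Iic (c - ρ)) f := by
      conv_lhs => rw [← hf, Q.proj_proj measurableSet_Ici.compl
        (measurableSet_Iic.union measurableSet_Ici)]
      congr 1
      congr 1
      ext x
      simp only [Set.mem_inter_iff, Set.mem_compl_iff, Set.mem_Ici, Set.mem_union, Set.mem_Iic]
      constructor
      · rintro ⟨h, h' | h'⟩
        · exact h'
        · exact absurd h' h
      · intro h; exact ⟨by linarith, Or.inl h⟩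
    rw [h1, h2, Q.proj_idem measurableSet_Iic]
  have l1 := hQ.le_re_inner measurableSet_Ici (a := c + ρ) (fun x hx => hx) hpp hpm
  have l2 := hQ.re_inner_le measurableSet_Iic (a := c - ρ) (fun x hx => hx) hqq hqm
  change (inner ℂ (f - p) (g - p')).re ≤ _ at l2
  change _ ≤ (inner ℂ p p').re at l1
  have o1 : inner ℂ (f - p) p' = 0 := hQ.inner_eq_zero measurableSet_Ici hpp hqp0 hpm hqm
  have o2 : inner ℂ p (g - p') = 0 := by
    rw [← hpp, Q.inner_proj_left measurableSet_Ici, map_sub, hp',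
      Q.proj_idem measurableSet_Ici, sub_self, inner_zero_right]
  have o3 : inner ℂ p (f - p) = 0 := by
    rw [← hpp, Q.inner_proj_left measurableSet_Ici, map_sub, hpp, hp,
      Q.proj_idem measurableSet_Ici, sub_self, inner_zero_right]
  have o4 : inner ℂ (f - p) p = 0 := by rw [← inner_conj_symm, o3, map_zero]
  have npq : ‖p‖ ^ 2 + ‖f - p‖ ^ 2 = ‖f‖ ^ 2 := by
    have := norm_add_sq_eq_norm_sq_add_norm_sq_of_inner_eq_zero p (f - p) o3
    rw [add_sub_cancel] at this
    linarith
  have npq' : ‖p - (f - p)‖ = ‖f‖ := by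
    have := norm_sub_sq (𝕜 := ℂ) p (f - p)
    rw [o3, map_zero, mul_zero, sub_zero, npq] at this
    exact (sq_eq_sq₀ (norm_nonneg _) (norm_nonneg _)).mp this
  have np : (inner ℂ p p).re = ‖p‖ ^ 2 := by rw [inner_self_eq_norm_sq_to_K]; norm_cast
  have nq : (inner ℂ (f - p) (f - p)).re = ‖f - p‖ ^ 2 := by
    rw [inner_self_eq_norm_sq_to_K]; norm_cast
  -- The test vector `p - (f - p)` is the sign of `A - c` applied to `f`: it has the norm of `f`,
  -- and pairing with it makes the contributions from above and from below `c` both positive, so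
  -- Cauchy-Schwarz suffices.
  have main : ρ * ‖f‖ ^ 2 ≤ (inner ℂ (p - (f - p)) (g - (c : ℂ) • f)).re := by
    have e : g - (c : ℂ) • f =
        (p' - (c : ℂ) • p) + ((g - p') - (c : ℂ) • (f - p)) := by module
    rw [e, inner_sub_left, inner_add_right, inner_add_right, inner_sub_right p p',
      inner_sub_right (f - p) p', inner_sub_right p (g - p'), inner_sub_right (f - p) (g - p')]
    simp only [inner_smul_right, o1, o2, o3, o4, Complex.sub_re, Complex.add_re,
      Complex.re_ofReal_mul, np, nq, Complex.zero_re]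
    nlinarith [npq]
  have cs : (inner ℂ (p - (f - p)) (g - (c : ℂ) • f)).re ≤ ‖f‖ * ‖g - (c : ℂ) • f‖ := by
    rw [← npq']
    exact re_inner_le_norm (𝕜 := ℂ) _ _
  rcases (norm_nonneg f).eq_or_lt with h0 | h0
  · rw [← h0, mul_zero]; exact norm_nonneg _
  · have := main.trans cs
    refine le_of_mul_le_mul_left ?_ h0
    linarith

/-- Each application of `A - c` expands the norm by at most `r` on the `Q`-subspace near `c`, and by
at least `ρ` on the `Q'`-subspace far from `c`. Since `A - c` preserves the former and commutes with
`Q'`, the comparison iterates. For `r < ρ`, letting `n → ∞` shows that the two subspaces are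
orthogonal. -/
lemma Represents.pow_mul_norm_proj_le {Q' : ProjMeasure 𝓗} (hQ : Q.Represents A)
    (hQ' : Q'.Represents A) (hA : IsSelfAdjoint A) {c r ρ : ℝ} (hr : 0 < r) (hρ : 0 < ρ) (n : ℕ)
    {f : 𝓗} (hf : Q.proj (Set.Icc (c - r) (c + r)) f = f) :
    ρ ^ n * ‖Q'.proj (Set.Iic (c - ρ) ∪ Set.Ici (c + ρ)) f‖ ≤ r ^ n * ‖f‖ := by
  have hT : MeasurableSet (Set.Iic (c - ρ) ∪ Set.Ici (c + ρ)) :=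
    measurableSet_Iic.union measurableSet_Ici
  induction n generalizing f with
  | zero => simpa using Q'.norm_proj_le hT f
  | succ n ih =>
    obtain ⟨g, hg⟩ := LinearPMap.mem_domain_iff.mp (hQ.mem_domain_of_bounded hf)
    have hgK := hQ.proj_apply_eq_self hA.dense_domain measurableSet_Icc hf hg
    have h1 := hQ.norm_sub_smul_le hA hr hf hg
    have h2 := hQ'.le_norm_sub_smul hA (Q'.proj_idem hT f) hρ
      (hQ'.proj_mem_graph hA.dense_domain hT hg)
    rw [← map_smul, ← map_sub] at h2
    have h3 := ih (f := g - (c : ℂ) • f) (by rw [map_sub, map_smul, hf, hgK])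
    calc ρ ^ (n + 1) * ‖Q'.proj (Set.Iic (c - ρ) ∪ Set.Ici (c + ρ)) f‖
        = ρ ^ n * (ρ * ‖Q'.proj (Set.Iic (c - ρ) ∪ Set.Ici (c + ρ)) f‖) := by ring
      _ ≤ ρ ^ n * ‖Q'.proj (Set.Iic (c - ρ) ∪ Set.Ici (c + ρ)) (g - (c : ℂ) • f)‖ := by gcongr
      _ ≤ r ^ n * ‖g - (c : ℂ) • f‖ := h3
      _ ≤ r ^ n * (r * ‖f‖) := by gcongr
      _ = r ^ (n + 1) * ‖f‖ := by ring

lemma Represents.proj_eq_zero_of_lt {Q' : ProjMeasure 𝓗} (hQ : Q.Represents A)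
    (hQ' : Q'.Represents A) (hA : IsSelfAdjoint A) {c r ρ : ℝ} (hr : 0 < r) (hρ : r < ρ)
    {f : 𝓗} (hf : Q.proj (Set.Icc (c - r) (c + r)) f = f) :
    Q'.proj (Set.Iic (c - ρ) ∪ Set.Ici (c + ρ)) f = 0 := by
  have hρ0 : 0 < ρ := hr.trans hρ
  have h0 : Filter.Tendsto (fun n : ℕ => (r / ρ) ^ n * ‖f‖) Filter.atTop (nhds (0 * ‖f‖)) :=
    (tendsto_pow_atTop_nhds_zero_of_lt_one (by positivity) ((div_lt_one hρ0).mpr hρ)).mul_const _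
  rw [zero_mul] at h0
  have := ge_of_tendsto' h0 fun n => show
      ‖Q'.proj (Set.Iic (c - ρ) ∪ Set.Ici (c + ρ)) f‖ ≤ (r / ρ) ^ n * ‖f‖ by
    have h := hQ.pow_mul_norm_proj_le hQ' hA hr hρ0 n hf
    rw [div_pow, div_mul_eq_mul_div, le_div_iff₀ (by positivity), mul_comm]
    exact h
  exact norm_le_zero_iff.mp this

lemma Represents.proj_Icc_eq_self {Q' : ProjMeasure 𝓗} (hQ : Q.Represents A)
    (hQ' : Q'.Represents A) (hA : IsSelfAdjoint A) {a b : ℝ} (hab : a ≤ b) {f : 𝓗}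
    (hf : Q.proj (Set.Icc a b) f = f) : Q'.proj (Set.Icc a b) f = f := by
  set c := (a + b) / 2 with hc
  set r := (b - a) / 2 with hr
  obtain ⟨μ, h1, -, -⟩ := hQ' f
  -- The comparison radius `r + 1/(2(n+1))` is strictly below `r + 1/(n+1)` and remains positive
  -- when `a = b`. The far sets exhaust the complement of `[a, b]`.
  have hT (n : ℕ) : μ (Set.Iic (c - (r + 1 / ((n : ℝ) + 1))) ∪
      Set.Ici (c + (r + 1 / ((n : ℝ) + 1)))) = 0 := by
    have hn : (0 : ℝ) < 1 / ((n : ℝ) + 1) := by positivity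
    rw [h1 _ (measurableSet_Iic.union measurableSet_Ici),
      hQ.proj_eq_zero_of_lt hQ' hA (r := r + 1 / ((n : ℝ) + 1) / 2) (by linarith) (by linarith)]
    · simp
    · refine Q.proj_eq_self_mono measurableSet_Icc measurableSet_Icc
        (Set.Icc_subset_Icc ?_ ?_) hf <;> linarith
  have h0 : μ (Set.Icc a b)ᶜ = 0 := by
    refine measure_mono_null (fun x hx => ?_) (measure_iUnion_null hT)
    rw [Set.mem_iUnion]
    rw [Set.mem_compl_iff, Set.mem_Icc, not_and_or, not_le, not_le] at hx
    rcases hx with hx | hx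
    · obtain ⟨n, hn⟩ := exists_nat_one_div_lt (sub_pos.mpr hx)
      exact ⟨n, Or.inl (by rw [Set.mem_Iic]; linarith)⟩
    · obtain ⟨n, hn⟩ := exists_nat_one_div_lt (sub_pos.mpr hx)
      exact ⟨n, Or.inr (by rw [Set.mem_Ici]; linarith)⟩
  rw [h1 _ measurableSet_Icc.compl, ENNReal.ofReal_eq_zero] at h0
  rw [← Q'.proj_compl_eq_zero_iff measurableSet_Icc]
  have : ‖Q'.proj (Set.Icc a b)ᶜ f‖ ^ 2 = 0 := le_antisymm h0 (sq_nonneg _)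
  simpa using this

/-- The spectral measure of a self-adjoint operator is unique. -/
theorem Represents.unique {Q' : ProjMeasure 𝓗} (hQ : Q.Represents A) (hQ' : Q'.Represents A)
    (hA : IsSelfAdjoint A) {S : Set ℝ} (hS : MeasurableSet S) : Q.proj S = Q'.proj S := by
  have hIcc {a b : ℝ} (hab : a ≤ b) : Q.proj (Set.Icc a b) = Q'.proj (Set.Icc a b) := by
    have e1 : Q'.proj (Set.Icc a b) * Q.proj (Set.Icc a b) = Q.proj (Set.Icc a b) := by
      ext1 f
      exact hQ.proj_Icc_eq_self hQ' hA hab (Q.proj_idem measurableSet_Icc f)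
    have e2 : Q.proj (Set.Icc a b) * Q'.proj (Set.Icc a b) = Q'.proj (Set.Icc a b) := by
      ext1 f
      exact hQ'.proj_Icc_eq_self hQ hA hab (Q'.proj_idem measurableSet_Icc f)
    have s1 := (Q.isStarProjection (Set.Icc a b) measurableSet_Icc).isSelfAdjoint.star_eq
    have s2 := (Q'.isStarProjection (Set.Icc a b) measurableSet_Icc).isSelfAdjoint.star_eq
    -- The adjoint of `Q' Q = Q` is `Q Q' = Q`, while `e2` says `Q Q' = Q'`.
    have e3 := congrArg star e1
    rw [star_mul, s1, s2, e2] at e3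
    exact e3.symm
  -- Finite measures on `ℝ` are determined by closed intervals, so the scalar measures agree on
  -- every Borel set; over `ℂ` the quadratic form then determines the operator.
  have hn (f : 𝓗) : ‖Q.proj S f‖ ^ 2 = ‖Q'.proj S f‖ ^ 2 := by
    obtain ⟨μ, h1, -, -⟩ := hQ f
    obtain ⟨ν, h1', -, -⟩ := hQ' f
    have hfin : IsFiniteMeasure μ := IsScalarMeasure.isFiniteMeasure h1
    have hμν : μ = ν := by
      refine Measure.ext_of_Icc μ ν fun a b hab => ?_
      rw [h1 _ measurableSet_Icc, h1' _ measurableSet_Icc, hIcc hab]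
    have := h1 S hS
    rw [hμν, h1' S hS, ENNReal.ofReal_eq_ofReal_iff (by positivity) (by positivity)] at this
    exact this.symm
  have := (ext_inner_map (Q.proj S : 𝓗 →ₗ[ℂ] 𝓗) (Q'.proj S : 𝓗 →ₗ[ℂ] 𝓗)).mp fun f => by
    change inner ℂ (Q.proj S f) f = inner ℂ (Q'.proj S f) f
    rw [Q.norm_proj_sq hS, Q'.norm_proj_sq hS, hn]
  ext1 f
  exact LinearMap.congr_fun this f

end ProjMeasure

end Operators

section Antiunitary

variable {𝓗 : Type} [NormedAddCommGroup 𝓗] [InnerProductSpace ℂ 𝓗]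

/-! ### Conjugation by an antiunitary operator -/

lemma inner_map_antiunitary (J : 𝓗 ≃ₗᵢ⋆[ℂ] 𝓗) (f g : 𝓗) :
    inner ℂ (J f) (J g) = inner ℂ g f := by
  have hre (f g : 𝓗) : (inner ℂ (J f) (J g)).re = (inner ℂ f g).re := by
    have h1 := norm_add_sq (𝕜 := ℂ) f g
    have h2 := norm_add_sq (𝕜 := ℂ) (J f) (J g)
    rw [← map_add, J.norm_map, J.norm_map, J.norm_map] at h2
    simp only [RCLike.re_to_complex] at h1 h2
    linarith
  rw [← inner_conj_symm g f]
  apply Complex.ext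
  · rw [hre, Complex.conj_re]
  -- An isometry preserves the real part by polarization; the imaginary part is read off at `i f`,
  -- where antilinearity produces the sign.
  · have h := hre (Complex.I • f) g
    rw [map_smulₛₗ, inner_smul_left, inner_smul_left] at h
    simp only [Complex.conj_I, map_neg, neg_mul, Complex.neg_re, Complex.mul_re, Complex.I_re,
      Complex.I_im, zero_mul, one_mul, zero_sub, neg_neg] at h
    rw [Complex.conj_im]
    linarith

/-- `T ↦ J T J⁻¹` for an antiunitary operator `J`. -/
def conjOp (J : 𝓗 ≃ₗᵢ⋆[ℂ] 𝓗) (T : 𝓗 →L[ℂ] 𝓗) : 𝓗 →L[ℂ] 𝓗 :=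
  (J.toContinuousLinearEquiv : 𝓗 →L⋆[ℂ] 𝓗).comp
    (T.comp (J.symm.toContinuousLinearEquiv : 𝓗 →L⋆[ℂ] 𝓗))

lemma conjOp_apply (J : 𝓗 ≃ₗᵢ⋆[ℂ] 𝓗) (T : 𝓗 →L[ℂ] 𝓗) (f : 𝓗) :
    conjOp J T f = J (T (J.symm f)) := rfl

lemma norm_conjOp_le (J : 𝓗 ≃ₗᵢ⋆[ℂ] 𝓗) (T : 𝓗 →L[ℂ] 𝓗) : ‖conjOp J T‖ ≤ ‖T‖ := by
  refine ContinuousLinearMap.opNorm_le_bound _ (norm_nonneg _) fun f => ?_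
  rw [conjOp_apply, J.norm_map]
  exact (T.le_opNorm _).trans_eq (by rw [J.symm.norm_map])

lemma conjOp_symm_conjOp (J : 𝓗 ≃ₗᵢ⋆[ℂ] 𝓗) (T : 𝓗 →L[ℂ] 𝓗) :
    conjOp J.symm (conjOp J T) = T := by
  ext1 f
  simp [conjOp_apply]

lemma conjOp_mul (J : 𝓗 ≃ₗᵢ⋆[ℂ] 𝓗) (S T : 𝓗 →L[ℂ] 𝓗) :
    conjOp J (S * T) = conjOp J S * conjOp J T := by
  ext1 f
  simp [conjOp_apply]

lemma conjOp_sub (J : 𝓗 ≃ₗᵢ⋆[ℂ] 𝓗) (S T : 𝓗 →L[ℂ] 𝓗) :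
    conjOp J (S - T) = conjOp J S - conjOp J T := by
  ext1 f
  simp [conjOp_apply]

/-- `T ↦ J T J⁻¹` as a real linear isometry of the bounded operators. -/
def conjOpₗᵢ (J : 𝓗 ≃ₗᵢ⋆[ℂ] 𝓗) : (𝓗 →L[ℂ] 𝓗) ≃ₗᵢ[ℝ] (𝓗 →L[ℂ] 𝓗) where
  toFun := conjOp J
  invFun := conjOp J.symm
  map_add' S T := by
    ext1 f
    simp [conjOp_apply]
  map_smul' c T := by
    ext1 f
    simp only [conjOp_apply, _root_.smul_apply, RingHom.id_apply]
    rw [← Complex.coe_smul, ← Complex.coe_smul, map_smulₛₗ, Complex.conj_ofReal]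
  left_inv T := conjOp_symm_conjOp J T
  right_inv T := conjOp_symm_conjOp J.symm T
  norm_map' T := le_antisymm (norm_conjOp_le J T)
    ((norm_conjOp_le J.symm (conjOp J T)).trans_eq' (by rw [conjOp_symm_conjOp]))

/-- The chosen trace value depends only on the predicate `HasTrace`, so equality of the predicates
suffices, whether or not a trace exists. -/
lemma trace_congr {S T : 𝓗 →L[ℂ] 𝓗} (h : ∀ z, HasTrace S z ↔ HasTrace T z) :
    trace S = trace T := by
  have : HasTrace S = HasTrace T := funext fun z => propext (h z)
  unfold trace IsTraceClass
  rw [this]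

variable [CompleteSpace 𝓗]

lemma conjOp_star (J : 𝓗 ≃ₗᵢ⋆[ℂ] 𝓗) (T : 𝓗 →L[ℂ] 𝓗) :
    conjOp J (star T) = star (conjOp J T) := by
  rw [ContinuousLinearMap.star_eq_adjoint, ContinuousLinearMap.star_eq_adjoint,
    ContinuousLinearMap.eq_adjoint_iff]
  intro f g
  rw [conjOp_apply, conjOp_apply]
  nth_rw 1 [← J.apply_symm_apply g]
  nth_rw 2 [← J.apply_symm_apply f]
  rw [inner_map_antiunitary, inner_map_antiunitary, ContinuousLinearMap.adjoint_inner_right]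

lemma isStarProjection_conjOp (J : 𝓗 ≃ₗᵢ⋆[ℂ] 𝓗) {T : 𝓗 →L[ℂ] 𝓗} (hT : IsStarProjection T) :
    IsStarProjection (conjOp J T) where
  isIdempotentElem := by
    rw [IsIdempotentElem, ← conjOp_mul, hT.isIdempotentElem.eq]
  isSelfAdjoint := by
    rw [IsSelfAdjoint, ← conjOp_star, hT.isSelfAdjoint.star_eq]

/-- The image of a Hilbert basis under an antiunitary operator. -/
def mapHilbertBasis {ι : Type*} (J : 𝓗 ≃ₗᵢ⋆[ℂ] 𝓗) (b : HilbertBasis ι ℂ 𝓗) :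
    HilbertBasis ι ℂ 𝓗 :=
  HilbertBasis.mkOfOrthogonalEqBot (v := fun i => J (b i))
    (by
      classical
      rw [orthonormal_iff_ite]
      intro i j
      rw [inner_map_antiunitary, orthonormal_iff_ite.mp b.orthonormal]
      simp only [eq_comm])
    (by
      rw [Submodule.eq_bot_iff]
      intro f hf
      have h : J.symm f = 0 := by
        refine b.repr.injective ?_
        ext i
        rw [b.repr_apply_apply, map_zero, ← inner_map_antiunitary J, J.apply_symm_apply]
        exact (Submodule.mem_orthogonal' _ _).mp hf _ (Submodule.subset_span ⟨i, rfl⟩)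
      simpa using h)

lemma mapHilbertBasis_apply {ι : Type*} (J : 𝓗 ≃ₗᵢ⋆[ℂ] 𝓗) (b : HilbertBasis ι ℂ 𝓗) (i : ι) :
    mapHilbertBasis J b i = J (b i) := by
  simp [mapHilbertBasis]

/-! ### Traces -/

lemma HasTrace.star {T : 𝓗 →L[ℂ] 𝓗} {z : ℂ} (h : HasTrace T z) :
    HasTrace (star T) (starRingEnd ℂ z) := by
  intro ι b
  have h1 := (h ι b).star
  simp only [Complex.star_def, inner_conj_symm] at h1
  simpa only [ContinuousLinearMap.star_eq_adjoint, ContinuousLinearMap.adjoint_inner_right]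
    using h1

/-- The diagonal of `J T J⁻¹` in a basis `b` is the conjugate of the diagonal of `T` in the basis
`J⁻¹ b`. -/
lemma HasTrace.conjOp {T : 𝓗 →L[ℂ] 𝓗} {z : ℂ} (h : HasTrace T z) (J : 𝓗 ≃ₗᵢ⋆[ℂ] 𝓗) :
    HasTrace (conjOp J T) (starRingEnd ℂ z) := by
  intro ι b
  have h1 := (h ι (mapHilbertBasis J.symm b)).star
  simp only [mapHilbertBasis_apply, Complex.star_def, inner_conj_symm] at h1
  refine h1.congr_fun fun i => ?_
  nth_rw 1 [← J.apply_symm_apply (b i)]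
  rw [conjOp_apply, inner_map_antiunitary]

/-! ### Transport of unbounded operators -/

variable {A B : 𝓗 →ₗ.[ℂ] 𝓗}

/-- The projection-valued measure `S ↦ J Q(S) J⁻¹`. -/
def ProjMeasure.map (J : 𝓗 ≃ₗᵢ⋆[ℂ] 𝓗) (Q : ProjMeasure 𝓗) : ProjMeasure 𝓗 where
  proj S := Piezo.conjOp J (Q.proj S)
  isStarProjection S hS := isStarProjection_conjOp J (Q.isStarProjection S hS)
  proj_univ := by
    rw [Q.proj_univ]
    ext1 f
    simp [conjOp_apply]
  proj_inter S T hS hT := by rw [Q.proj_inter S T hS hT, conjOp_mul]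
  hasSum_proj S hS hd f := by
    simp only [conjOp_apply]
    exact (Q.hasSum_proj S hS hd (J.symm f)).map J J.continuous

/-- The same scalar measure serves for `f` and `J f`, since `J` is isometric and the integral, being
real, is unaffected by conjugation. -/
lemma ProjMeasure.Represents.map (J : 𝓗 ≃ₗᵢ⋆[ℂ] 𝓗)
    (hAB : ∀ f g, (J f, J g) ∈ B.graph ↔ (f, g) ∈ A.graph) {Q : ProjMeasure 𝓗}
    (hQ : Q.Represents A) : (Q.map J).Represents B := by
  intro f
  obtain ⟨f, rfl⟩ := J.surjective f
  obtain ⟨μ, h1, h2, h3⟩ := hQ f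
  refine ⟨μ, fun S hS => ?_, ?_, fun g hg => ?_⟩
  · rw [h1 S hS, ProjMeasure.map, conjOp_apply, J.norm_map, J.symm_apply_apply]
  · rw [← h2, LinearPMap.mem_domain_iff, LinearPMap.mem_domain_iff]
    refine ⟨fun ⟨g, hg⟩ => ⟨J.symm g, ?_⟩, fun ⟨g, hg⟩ => ⟨J g, (hAB f g).mpr hg⟩⟩
    rw [← hAB, J.apply_symm_apply]
    exact hg
  · obtain ⟨g, rfl⟩ := J.surjective g
    rw [inner_map_antiunitary, ← inner_conj_symm, h3 g ((hAB f g).mp hg), Complex.conj_ofReal]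

/-! ### Ordered eigenvalues and eigenprojections -/

lemma IsEigenvalueEnumeration.map (J : 𝓗 ≃ₗᵢ⋆[ℂ] 𝓗)
    (hAB : ∀ f g, (J f, J g) ∈ B.graph ↔ (f, g) ∈ A.graph) {e : ℕ → ℝ}
    (he : IsEigenvalueEnumeration A e) : IsEigenvalueEnumeration B e := by
  obtain ⟨h1, φ, h2⟩ := he
  refine ⟨h1, mapHilbertBasis J φ, fun n => ?_⟩
  have h3 := (hAB _ _).mpr (h2 n)
  rw [map_smulₛₗ, Complex.conj_ofReal] at h3
  rwa [mapHilbertBasis_apply]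

/-- If `e m < e' m`, then `φ 0, …, φ m` are orthogonal to every `φ' j` with `j ≥ m`, as eigenvectors
of a self-adjoint operator for distinct eigenvalues. These `m + 1` independent vectors would lie in
the span of the `m` vectors `φ' 0, …, φ' (m - 1)`. -/
lemma IsEigenvalueEnumeration.le (hA : IsSelfAdjoint A) {e e' : ℕ → ℝ}
    (he : IsEigenvalueEnumeration A e) (he' : IsEigenvalueEnumeration A e') (m : ℕ) :
    e' m ≤ e m := by
  classical
  by_contra! hlt
  obtain ⟨h1, φ, h2⟩ := he
  obtain ⟨h1', φ', h2'⟩ := he'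
  have horth {i j : ℕ} (hi : i ≤ m) (hj : m ≤ j) : inner ℂ (φ' j) (φ i) = 0 := by
    have h := inner_comm_of_mem_graph hA (h2 i) (h2' j)
    rw [inner_smul_left, inner_smul_right, Complex.conj_ofReal] at h
    have hne : (e' j : ℂ) - e i ≠ 0 := by
      rw [sub_ne_zero, Ne, Complex.ofReal_inj]
      exact ((h1 hi).trans_lt (hlt.trans_le (h1' hj))).ne'
    have h0 : ((e' j : ℂ) - e i) * inner ℂ (φ' j) (φ i) = 0 := by linear_combination h
    exact (mul_eq_zero.mp h0).resolve_left hne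
  have hspan (i : Fin (m + 1)) :
      φ i ∈ Submodule.span ℂ (Set.range fun j : Fin m => φ' j) := by
    have h := φ'.hasSum_repr (φ i)
    have h' := hasSum_sum_of_ne_finset_zero (L := .unconditional ℕ) (s := Finset.range m)
      (f := fun j => φ'.repr (φ i) j • φ' j) fun j hj => by
        rw [φ'.repr_apply_apply, horth (by lia) (by simpa using hj), zero_smul]
    rw [h.unique h']
    refine Submodule.sum_mem _ fun j hj => Submodule.smul_mem _ _ (Submodule.subset_span ?_)
    exact ⟨⟨j, Finset.mem_range.mp hj⟩, rfl⟩
  have hli : LinearIndependent ℂ fun i : Fin (m + 1) => φ i :=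
    φ.orthonormal.linearIndependent.comp _ Fin.val_injective
  have hc := linearIndependent_le_span_aux' _ hli (Set.range fun j : Fin m => φ' j)
    (Set.range_subset_iff.mpr hspan)
  have hc' := Fintype.card_range_le fun j : Fin m => φ' j
  rw [Fintype.card_fin] at hc hc'
  lia

lemma IsEigenvalueEnumeration.unique (hA : IsSelfAdjoint A) {e e' : ℕ → ℝ}
    (he : IsEigenvalueEnumeration A e) (he' : IsEigenvalueEnumeration A e') : e = e' :=
  funext fun m => le_antisymm (he'.le hA he m) (he.le hA he' m)

lemma eigenprojection_map (J : 𝓗 ≃ₗᵢ⋆[ℂ] 𝓗)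
    (hAB : ∀ f g, (J f, J g) ∈ B.graph ↔ (f, g) ∈ A.graph) (e : ℝ) :
    eigenprojection B e = Piezo.conjOp J (eigenprojection A e) := by
  have hmem (f : 𝓗) : f ∈ eigenspace A e ↔ J f ∈ eigenspace B e := by
    change (f, (e : ℂ) • f) ∈ A.graph ↔ (J f, (e : ℂ) • J f) ∈ B.graph
    rw [← hAB, map_smulₛₗ, Complex.conj_ofReal]
  have himg : (eigenspace B e : Set 𝓗) = J '' (eigenspace A e) := by
    ext f
    obtain ⟨f, rfl⟩ := J.surjective f
    simp [hmem]
  have hcl (f : 𝓗) : f ∈ (eigenspace A e).topologicalClosure ↔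
      J f ∈ (eigenspace B e).topologicalClosure := by
    rw [← SetLike.mem_coe, ← SetLike.mem_coe, Submodule.topologicalClosure_coe,
      Submodule.topologicalClosure_coe, himg]
    have h := J.toHomeomorph.image_closure (eigenspace A e)
    rw [J.coe_toHomeomorph] at h
    rw [← h, J.injective.mem_set_image]
  ext1 f
  rw [eigenprojection, eigenprojection, conjOp_apply]
  refine (Submodule.eq_starProjection_of_mem_of_inner_eq_zero ?_ fun w hw => ?_)
  · exact (hcl _).mp (Submodule.starProjection_apply_mem _ _)
  · obtain ⟨w, rfl⟩ := J.surjective w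
    nth_rw 1 [← J.apply_symm_apply f]
    rw [← map_sub, inner_map_antiunitary, ← inner_conj_symm,
      Submodule.starProjection_inner_eq_zero _ _ ((hcl w).mpr hw), map_zero]

end Antiunitary

/-! ### Complex conjugation on `L²` and the Zak transform -/

/-- Complex conjugation on `L²`. -/
def conjL2 {α : Type*} [MeasurableSpace α] (μ : Measure α) : Lp ℂ 2 μ ≃ₗᵢ⋆[ℂ] Lp ℂ 2 μ where
  toFun f := star f
  invFun f := star f
  left_inv f := star_star f
  right_inv f := star_star f
  map_add' f g := by
    apply Lp.ext
    filter_upwards [Lp.coeFn_star (f + g), Lp.coeFn_add f g, Lp.coeFn_add (star f) (star g),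
      Lp.coeFn_star f, Lp.coeFn_star g] with x h1 h2 h3 h4 h5
    rw [h1, h3, Pi.add_apply, h4, h5, Pi.star_apply, h2, Pi.add_apply, star_add, Pi.star_apply,
      Pi.star_apply]
  map_smul' c f := by
    apply Lp.ext
    filter_upwards [Lp.coeFn_star (c • f), Lp.coeFn_smul c f,
      Lp.coeFn_smul (starRingEnd ℂ c) (star f), Lp.coeFn_star f] with x h1 h2 h3 h4
    rw [h1, h3, Pi.smul_apply, h4, Pi.star_apply, h2, Pi.smul_apply, star_smul, Pi.star_apply]
    rfl
  norm_map' f := by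
    change ‖star f‖ = ‖f‖
    refine le_antisymm (Lp.norm_le_norm_of_ae_le ?_) (Lp.norm_le_norm_of_ae_le ?_) <;>
    · filter_upwards [Lp.coeFn_star f] with x h1
      rw [h1, Pi.star_apply, norm_star]

lemma conjL2_apply {α : Type*} [MeasurableSpace α] {μ : Measure α} (f : Lp ℂ 2 μ) :
    conjL2 μ f = star f := rfl

section Zak

variable {d : ℕ} (γ : Module.Basis (Fin d) ℝ (Space d))

/-- Complex conjugation on the fibre space. -/
abbrev fiberConj : FiberSpace γ ≃ₗᵢ⋆[ℂ] FiberSpace γ :=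
  conjL2 ((volume : Measure (Space d)).restrict (cell γ))

lemma neg_mem_cell {x : Space d} (hx : x ∈ cell γ) : -x ∈ cell γ := by
  intro l
  have h := hx l
  rw [map_neg, Finsupp.neg_apply]
  exact ⟨by linarith [h.2], by linarith [h.1]⟩

lemma neg_preimage_cell : Neg.neg ⁻¹' cell γ = cell γ := by
  ext x
  exact ⟨fun h => by simpa using neg_mem_cell γ h, fun h => neg_mem_cell γ h⟩

lemma measurePreserving_neg_brillouinMeasure :
    MeasurePreserving (fun k : Space d => -k) (brillouinMeasure γ) (brillouinMeasure γ) := by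
  have h := (Measure.measurePreserving_neg (volume : Measure (Space d))).restrict_preimage
    (measurableSet_cell (dual γ))
  rw [neg_preimage_cell] at h
  exact h.smul_measure _

lemma measure_cell_ne_top : volume (cell γ) ≠ ⊤ := by
  refine ((measure_mono fun x hx => ?_).trans_lt
    (measure_closedBall_lt_top (x := (0 : Space d)) (r := ∑ l, ‖γ l‖))).ne
  rw [mem_closedBall_zero_iff]
  exact norm_le_of_mem_cell γ hx

lemma ae_brillouinMeasure_iff {p : Space d → Prop} :
    (∀ᵐ k ∂(brillouinMeasure γ), p k) ↔ ∀ᵐ k ∂(volume.restrict (cell (dual γ))), p k :=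
  Measure.ae_ennreal_smul_measure_iff (ENNReal.inv_ne_zero.mpr (measure_cell_ne_top (dual γ)))

/-- The map `Φ ↦ (k ↦ conj Φ(-k))`. -/
def zakReflect : ZakSpace γ →L⋆[ℂ] ZakSpace γ :=
  (((fiberConj γ).toContinuousLinearEquiv : FiberSpace γ →L⋆[ℂ] FiberSpace γ).compLpL 2
    (brillouinMeasure γ)).comp
    (Lp.compMeasurePreservingₗᵢ ℂ (fun k : Space d => -k)
      (measurePreserving_neg_brillouinMeasure γ)).toContinuousLinearMap

lemma coeFn_zakReflect (Φ : ZakSpace γ) :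
    zakReflect γ Φ =ᵐ[brillouinMeasure γ] fun k => star (Φ (-k)) := by
  have h1 := ContinuousLinearMap.coeFn_compLpL (p := 2) (μ := brillouinMeasure γ)
    ((fiberConj γ).toContinuousLinearEquiv : FiberSpace γ →L⋆[ℂ] FiberSpace γ)
    (Lp.compMeasurePreserving (fun k : Space d => -k)
      (measurePreserving_neg_brillouinMeasure γ) Φ)
  have h2 := Lp.coeFn_compMeasurePreserving Φ (measurePreserving_neg_brillouinMeasure γ)
  filter_upwards [h1, h2] with k h1 h2
  refine h1.trans ?_
  rw [h2]
  rfl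

lemma zakReflect_zakReflect (Φ : ZakSpace γ) : zakReflect γ (zakReflect γ Φ) = Φ := by
  apply Lp.ext
  have h := (measurePreserving_neg_brillouinMeasure γ).quasiMeasurePreserving.ae
    (coeFn_zakReflect γ Φ)
  filter_upwards [coeFn_zakReflect γ (zakReflect γ Φ), h] with k h1 h2
  rw [h1, h2, star_star, neg_neg]

lemma phase_star (k : Space d) (f : FiberSpace γ) :
    phase γ k (star f) = star (phase γ (-k) f) := by
  apply Lp.ext
  filter_upwards [(memLp_phase γ k (star f)).coeFn_toLp, (memLp_phase γ (-k) f).coeFn_toLp,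
    Lp.coeFn_star f, Lp.coeFn_star (phase γ (-k) f)] with y h1 h2 h3 h4
  rw [h4, Pi.star_apply, phase, phase, h1, h2, h3, Pi.star_apply, star_mul', Complex.star_def,
    ← Complex.exp_conj, map_mul, Complex.conj_I, Complex.conj_ofReal, inner_neg_right]
  congr 2
  push_cast
  ring

lemma phase_phase (k k' : Space d) (f : FiberSpace γ) :
    phase γ k (phase γ k' f) = phase γ (k + k') f := by
  apply Lp.ext
  filter_upwards [(memLp_phase γ k (phase γ k' f)).coeFn_toLp,
    (memLp_phase γ k' f).coeFn_toLp, (memLp_phase γ (k + k') f).coeFn_toLp] with y h1 h2 h3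
  rw [phase, h1, phase, h2, phase, h3, ← mul_assoc, ← Complex.exp_add, inner_add_right]
  congr 2
  push_cast
  ring

lemma phase_zero (f : FiberSpace γ) : phase γ 0 f = f := by
  apply Lp.ext
  filter_upwards [(memLp_phase γ 0 f).coeFn_toLp] with y h1
  rw [phase, h1]
  simp

lemma shiftRestrict_star (a : Space d) (ψ : L2 d) :
    shiftRestrict γ a (star ψ) = star (shiftRestrict γ a ψ) := by
  apply Lp.ext
  have mp := measurePreserving_add_right (volume : Measure (Space d)) a
  have h1 (χ : L2 d) : shiftRestrict γ a χ =ᵐ[volume.restrict (cell γ)] fun y => χ (y + a) := by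
    refine (LpToLpRestrictCLM_coeFn ℂ (cell γ) _).trans (ae_restrict_of_ae ?_)
    exact Lp.coeFn_compMeasurePreserving χ mp
  filter_upwards [h1 (star ψ), h1 ψ, Lp.coeFn_star (shiftRestrict γ a ψ),
    ae_restrict_of_ae (mp.quasiMeasurePreserving.ae (Lp.coeFn_star ψ))] with y h1 h2 h3 h4
  rw [h1, h3, Pi.star_apply, h2, h4, Pi.star_apply]

lemma zakSection_star (a : Space d) (ψ : L2 d) (k : Space d) :
    zakSection γ a (star ψ) k = star (zakSection γ a ψ (-k)) := by
  rw [zakSection, zakSection, shiftRestrict_star, phase_star, ← conjL2_apply, ← conjL2_apply,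
    map_smulₛₗ, ← Complex.exp_conj, map_mul, Complex.conj_I, Complex.conj_ofReal,
    inner_neg_right]
  congr 2
  push_cast
  ring

lemma zak_star (ψ : L2 d) : zak γ (star ψ) = zakReflect γ (zak γ ψ) := by
  -- The reflection is an involution, hence a continuous equivalence, and as such commutes with
  -- `tsum` without any summability hypothesis.
  let e : ZakSpace γ ≃L⋆[ℂ] ZakSpace γ :=
    ContinuousLinearEquiv.equivOfInverse (zakReflect γ) (zakReflect γ)
      (zakReflect_zakReflect γ) (zakReflect_zakReflect γ)
  change _ = e (zak γ ψ)
  rw [zak, zak, e.map_tsum]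
  refine tsum_congr fun a => ?_
  change _ = zakReflect γ _
  apply Lp.ext
  have h := (measurePreserving_neg_brillouinMeasure γ).quasiMeasurePreserving.ae
    (memLp_zakSection γ (a : Space d) ψ).coeFn_toLp
  filter_upwards [(memLp_zakSection γ (a : Space d) (star ψ)).coeFn_toLp,
    coeFn_zakReflect γ ((memLp_zakSection γ (a : Space d) ψ).toLp _), h] with k h1 h2 h3
  rw [h1, h2, h3, zakSection_star]

/-! ### Time reversal of the fibres -/

/-- Lets an almost everywhere identity between continuous functions extend to the whole closed cell,
boundary included. -/
lemma closure_interior_cell : closure (interior (cell γ)) = cell γ := by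
  have h : cell γ = γ.equivFunL.toHomeomorph ⁻¹'
      (Set.univ.pi fun _ => Set.Icc (-(1 / 2) : ℝ) (1 / 2)) := by
    ext x
    simp only [cell, Set.mem_ofPred_eq, Set.mem_preimage, Set.mem_univ_pi]
    rfl
  rw [h, ← Homeomorph.preimage_interior, ← Homeomorph.preimage_closure,
    interior_pi_set Set.finite_univ, closure_pi_set]
  congr 2
  ext1 l
  exact closure_interior_Icc (by norm_num)

lemma exists_mem_cell_add_mem_lattice (k : Space d) :
    ∃ k₀ ∈ cell γ, ∃ κ ∈ lattice γ, k = k₀ + κ := by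
  refine ⟨k - ∑ l, round (γ.repr k l) • γ l, fun l => ?_, ∑ l, round (γ.repr k l) • γ l,
    Submodule.sum_mem _ fun l _ => Submodule.smul_mem _ _ (Submodule.subset_span ⟨l, rfl⟩),
    by simp⟩
  have h : γ.repr (∑ l, round (γ.repr k l) • γ l) l = round (γ.repr k l) := by
    simp [← Int.cast_smul_eq_zsmul ℝ, Finsupp.single_apply]
  rw [map_sub, Finsupp.sub_apply, h]
  have := abs_le.mp (abs_sub_round (γ.repr k l))
  exact ⟨by linarith [this.1], this.2⟩

variable {γ} {A : L2 d →ₗ.[ℂ] L2 d} {h : Space d → FiberSpace γ →ₗ.[ℂ] FiberSpace γ}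

/-- Pull the pair back to the graph of `A`, conjugate there, and transform again. -/
lemma IsFiberDecomposition.reflect (hd : IsFiberDecomposition γ A h) (hC : CommutesWithConj A)
    {Φ Ξ : ZakSpace γ} (hΦ : ∀ᵐ k ∂(brillouinMeasure γ), (Φ k, Ξ k) ∈ (h k).graph) :
    ∀ᵐ k ∂(brillouinMeasure γ), (star (Φ (-k)), star (Ξ (-k))) ∈ (h k).graph := by
  have h1 : (Φ, Ξ) ∈ {p : ZakSpace γ × ZakSpace γ |
    ∀ᵐ k ∂(brillouinMeasure γ), (p.1 k, p.2 k) ∈ (h k).graph} := hΦ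
  rw [← hd] at h1
  obtain ⟨⟨ψ, χ⟩, hm, he⟩ := h1
  obtain ⟨rfl, rfl⟩ := Prod.mk.inj he
  have h2 := Set.mem_image_of_mem (fun p : L2 d × L2 d => (zak γ p.1, zak γ p.2)) (hC ψ χ hm)
  rw [hd] at h2
  have h3 : ∀ᵐ k ∂(brillouinMeasure γ), (zak γ (star ψ) k, zak γ (star χ) k) ∈ (h k).graph := h2
  rw [zak_star, zak_star] at h3
  filter_upwards [h3, coeFn_zakReflect γ (zak γ ψ), coeFn_zakReflect γ (zak γ χ)]
    with k h3 h4 h5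
  rwa [h4, h5] at h3

lemma memLp_brillouinMeasure_of_continuous {E : Type*} [NormedAddCommGroup E]
    {F : Space d → E} (hF : Continuous F) : MemLp F 2 (brillouinMeasure γ) := by
  obtain ⟨C, hC⟩ := (isCompact_closedBall (0 : Space d)
    (∑ l, ‖dual γ l‖)).exists_bound_of_continuousOn hF.continuousOn
  refine MemLp.of_bound hF.aestronglyMeasurable C ?_
  rw [ae_brillouinMeasure_iff]
  filter_upwards [ae_restrict_mem (measurableSet_cell (dual γ))] with k hk
  exact hC k (mem_closedBall_zero_iff.mpr (norm_le_of_mem_cell (dual γ) hk))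

/-- Weak form of `C R(-k) C = R(k)*`. The reflected section `k ↦ R(k) g` lies in the graph of `h k`
for almost every `k`; symmetry of `h k` against `R k u` gives the identity there, and only strong
continuity of `R` is needed to pass to all `k` in the cell. -/
lemma IsContinuouslyFibered.inner_resolvent (hh : IsContinuouslyFibered γ A h)
    (hC : CommutesWithConj A) {R : Space d → FiberSpace γ →L[ℂ] FiberSpace γ}
    (hR : ∀ k, IsResolvent (h k) Complex.I (R k)) (hRc : ∀ f, Continuous fun k => R k f)
    {k : Space d} (hk : k ∈ cell (dual γ)) (u g : FiberSpace γ) :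
    inner ℂ (R k u) (star g) = inner ℂ u (star (R (-k) g)) := by
  have m1 := memLp_brillouinMeasure_of_continuous (γ := γ) (hRc g)
  have m2 := memLp_brillouinMeasure_of_continuous (γ := γ)
    (F := fun k => g + Complex.I • R k g) (by have := hRc g; fun_prop)
  have h1 := hh.decomposition.reflect hC (Φ := m1.toLp _) (Ξ := m2.toLp _) (by
    filter_upwards [m1.coeFn_toLp, m2.coeFn_toLp] with k e1 e2
    rw [e1, e2]
    exact (hR k).1 g)
  have qmp := (measurePreserving_neg_brillouinMeasure γ).quasiMeasurePreserving
  have h2 : ∀ᵐ k ∂(brillouinMeasure γ),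
      inner ℂ (R k u) (star g) = inner ℂ u (star (R (-k) g)) := by
    filter_upwards [h1, qmp.ae m1.coeFn_toLp, qmp.ae m2.coeFn_toLp] with k h1 e1 e2
    rw [e1, e2, ← conjL2_apply, ← conjL2_apply, map_add, map_smulₛₗ, Complex.conj_I] at h1
    have h3 := inner_comm_of_mem_graph (hh.selfAdjoint k) h1 ((hR k).1 u)
    rw [inner_add_left, inner_smul_left, inner_add_right, inner_smul_right, Complex.conj_I] at h3
    rw [← conjL2_apply, ← conjL2_apply]
    linear_combination -h3
  rw [ae_brillouinMeasure_iff] at h2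
  have c1 : Continuous fun k => inner ℂ (R k u) (star g) := (hRc u).inner continuous_const
  have c2 : Continuous fun k => inner ℂ u (star (R (-k) g)) :=
    continuous_const.inner ((fiberConj γ).continuous.comp ((hRc g).comp continuous_neg))
  exact Measure.eqOn_of_ae_eq h2 c1.continuousOn c2.continuousOn
    (closure_interior_cell (dual γ)).ge hk

lemma IsContinuouslyFibered.star_mem_graph_of_mem_cell (hh : IsContinuouslyFibered γ A h)
    (hC : CommutesWithConj A) {k : Space d} (hk : k ∈ cell (dual γ)) {f g : FiberSpace γ}
    (hfg : (f, g) ∈ (h (-k)).graph) : (star f, star g) ∈ (h k).graph := by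
  obtain ⟨R, hR, hRc⟩ := hh.continuous
  rw [mem_graph_iff_of_isSelfAdjoint (hh.selfAdjoint k)]
  intro x y hxy
  -- With `u = (h(k) - i) x` and `g - i f = (h(-k) - i) f` the resolvents disappear, and what
  -- remains is the symmetry criterion for membership in the graph of `h k`.
  have h1 := hh.inner_resolvent hC hR hRc hk (y - Complex.I • x) (g - Complex.I • f)
  rw [(hR k).2 x y hxy, (hR (-k)).2 f g hfg, ← conjL2_apply, ← conjL2_apply, map_sub,
    map_smulₛₗ, inner_sub_right, inner_sub_left, inner_smul_left, inner_smul_right] at h1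
  rw [← conjL2_apply, ← conjL2_apply]
  linear_combination -h1

/-- Time-reversal symmetry of the fibre operators. -/
theorem IsContinuouslyFibered.star_mem_graph_iff (hh : IsContinuouslyFibered γ A h)
    (hC : CommutesWithConj A) (k : Space d) (f g : FiberSpace γ) :
    (star f, star g) ∈ (h k).graph ↔ (f, g) ∈ (h (-k)).graph := by
  have key (k : Space d) (f g : FiberSpace γ) (hfg : (f, g) ∈ (h (-k)).graph) :
      (star f, star g) ∈ (h k).graph := by
    obtain ⟨k₀, hk₀, κ, hκ, rfl⟩ := exists_mem_cell_add_mem_lattice (dual γ) k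
    -- Equivariance by `κ` moves `-k₀ - κ` to `-k₀`, and after conjugation `k₀` to `k₀ + κ`.
    -- Conjugation inverts a phase, so the two phases cancel.
    have h1 := hh.equivariant _ κ hκ f g hfg
    rw [neg_add, neg_add_cancel_right] at h1
    have h2 := hh.star_mem_graph_of_mem_cell hC hk₀ h1
    have h3 := hh.equivariant _ κ hκ _ _ h2
    rwa [phase_star, phase_star, phase_phase, phase_phase, neg_add_cancel, phase_zero,
      phase_zero] at h3
  refine ⟨fun hfg => ?_, key k f g⟩
  have h1 := key (-k) (star f) (star g) (by rwa [neg_neg])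
  rwa [star_star, star_star] at h1

end Zak

variable {d : ℕ} {γ : Module.Basis (Fin d) ℝ (Space d)}

/-! ### Symmetry of the projectors -/

lemma IsFermiProjector.isStarProjection {I : Set ℝ} {H : ℝ → L2 d →ₗ.[ℂ] L2 d}
    {h : Space d → ℝ → FiberSpace γ →ₗ.[ℂ] FiberSpace γ}
    {P : Space d → ℝ → FiberSpace γ →L[ℂ] FiberSpace γ} (hP : IsFermiProjector γ I H h P)
    {t : ℝ} (ht : t ∈ I) (k : Space d) : IsStarProjection (P k t) := by
  obtain ⟨E, hE⟩ := hP
  obtain ⟨Q, -, hQ⟩ := (hE t ht).2 k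
  rw [hQ]
  exact Q.isStarProjection _ measurableSet_Iio

lemma IsBlochProjector.isStarProjection {I : Set ℝ}
    {h : Space d → ℝ → FiberSpace γ →ₗ.[ℂ] FiberSpace γ}
    {P : Space d → ℝ → FiberSpace γ →L[ℂ] FiberSpace γ} (hP : IsBlochProjector γ I h P)
    {t : ℝ} (ht : t ∈ I) (k : Space d) : IsStarProjection (P k t) := by
  obtain ⟨e, m, hE⟩ := hP
  rw [(hE t ht).2.2 k]
  exact isStarProjection_starProjection

lemma IsFermiProjector.eq_conjOp {I : Set ℝ} {H : ℝ → L2 d →ₗ.[ℂ] L2 d}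
    {h : Space d → ℝ → FiberSpace γ →ₗ.[ℂ] FiberSpace γ}
    {P : Space d → ℝ → FiberSpace γ →L[ℂ] FiberSpace γ} (hP : IsFermiProjector γ I H h P)
    {t : ℝ} (ht : t ∈ I) (hC : CommutesWithConj (H t))
    (hh : IsContinuouslyFibered γ (H t) fun k => h k t) (k : Space d) :
    P k t = conjOp (fiberConj γ) (P (-k) t) := by
  obtain ⟨E, hE⟩ := hP
  obtain ⟨Q, hQ, hQP⟩ := (hE t ht).2 k
  obtain ⟨Q', hQ', hQP'⟩ := (hE t ht).2 (-k)
  rw [hQP, hQP']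
  exact hQ.unique (hQ'.map (fiberConj γ) (hh.star_mem_graph_iff hC k)) (hh.selfAdjoint k)
    measurableSet_Iio

lemma IsBlochProjector.eq_conjOp {I : Set ℝ} {A : L2 d →ₗ.[ℂ] L2 d}
    {h : Space d → ℝ → FiberSpace γ →ₗ.[ℂ] FiberSpace γ}
    {P : Space d → ℝ → FiberSpace γ →L[ℂ] FiberSpace γ} (hP : IsBlochProjector γ I h P)
    {t : ℝ} (ht : t ∈ I) (hC : CommutesWithConj A)
    (hh : IsContinuouslyFibered γ A fun k => h k t) (k : Space d) :
    P k t = conjOp (fiberConj γ) (P (-k) t) := by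
  obtain ⟨e, m, hE⟩ := hP
  obtain ⟨he, -, hP⟩ := hE t ht
  have hAB := hh.star_mem_graph_iff hC k
  -- Conjugation carries the enumeration at `-k` to one for `h k t`, so the band functions are even
  -- in `k`.
  have heq := (he k).unique (hh.selfAdjoint k) ((he (-k)).map (fiberConj γ) hAB)
  rw [hP k, hP (-k), heq]
  exact eigenprojection_map (fiberConj γ) hAB _

/-! ### Symmetry of the piezocurvature -/

section Calculus

variable {𝓗 : Type} [NormedAddCommGroup 𝓗] [InnerProductSpace ℂ 𝓗] {E : Type*}
  [NormedAddCommGroup E] [NormedSpace ℝ E] {F : E → 𝓗 →L[ℂ] 𝓗} {s : Set E} {x : E}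

/-- Leibniz rule for `F = F²`. Without differentiability the derivative is zero by convention and
the identity persists. -/
lemma fderivWithin_eq_mul_add (hs : UniqueDiffWithinAt ℝ s x) (hx : x ∈ s)
    (hF : ∀ q ∈ s, IsIdempotentElem (F q)) (v : E) :
    fderivWithin ℝ F s x v = F x * fderivWithin ℝ F s x v + fderivWithin ℝ F s x v * F x := by
  by_cases hd : DifferentiableWithinAt ℝ F s x
  · have h : Set.EqOn F (fun q => F q * F q) s := fun q hq => (hF q hq).eq.symm
    have h' := (hd.hasFDerivWithinAt.mul' hd.hasFDerivWithinAt).fderivWithin hs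
    have h'' := DFunLike.congr_fun ((fderivWithin_congr h (h hx)).trans h') v
    exact h''
  · simp [fderivWithin_zero_of_not_differentiableWithinAt hd]

lemma fderivWithin_isSelfAdjoint [CompleteSpace 𝓗] (hs : UniqueDiffWithinAt ℝ s x) (hx : x ∈ s)
    (hF : ∀ q ∈ s, IsSelfAdjoint (F q)) (v : E) : IsSelfAdjoint (fderivWithin ℝ F s x v) := by
  have h : Set.EqOn F (fun q => star (F q)) s := fun q hq => (hF q hq).star_eq.symm
  have h' := DFunLike.congr_fun ((fderivWithin_congr h (h hx)).trans (fderivWithin_star hs)) v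
  exact h'.symm

variable (J : 𝓗 ≃ₗᵢ⋆[ℂ] 𝓗)

lemma differentiableWithinAt_conjOp_iff :
    DifferentiableWithinAt ℝ (fun q => conjOp J (F q)) s x ↔ DifferentiableWithinAt ℝ F s x :=
  (conjOpₗᵢ J).toContinuousLinearEquiv.comp_differentiableWithinAt_iff

lemma fderivWithin_conjOp (hs : UniqueDiffWithinAt ℝ s x) (v : E) :
    fderivWithin ℝ (fun q => conjOp J (F q)) s x v = conjOp J (fderivWithin ℝ F s x v) :=
  DFunLike.congr_fun ((conjOpₗᵢ J).toContinuousLinearEquiv.comp_fderivWithin (f := F) hs) v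

lemma differentiableAt_neg_iff_of_conjOp (hJ : ∀ q, F (-q) = conjOp J (F q)) :
    DifferentiableAt ℝ F (-x) ↔ DifferentiableAt ℝ F x := by
  have e : F ∘ ContinuousLinearEquiv.neg ℝ = (conjOpₗᵢ J).toContinuousLinearEquiv ∘ F :=
    funext fun q => hJ q
  rw [← (conjOpₗᵢ J).toContinuousLinearEquiv.comp_differentiableAt_iff (f := F) (x := x), ← e,
    ContinuousLinearEquiv.comp_right_differentiableAt_iff]
  rfl

lemma fderiv_neg_of_conjOp (hJ : ∀ q, F (-q) = conjOp J (F q)) (v : E) :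
    fderiv ℝ F (-x) v = -conjOp J (fderiv ℝ F x v) := by
  have e : F ∘ ContinuousLinearEquiv.neg ℝ = (conjOpₗᵢ J).toContinuousLinearEquiv ∘ F :=
    funext fun q => hJ q
  have h := congrArg (fun F => fderiv ℝ F x v) e
  simp only [ContinuousLinearEquiv.comp_right_fderiv, ContinuousLinearEquiv.comp_fderiv] at h
  change fderiv ℝ F (-x) (-v) = conjOp J (fderiv ℝ F x v) at h
  rw [map_neg] at h
  exact neg_eq_iff_eq_neg.mp h

end Calculus

/-! ### The curvature operator and its trace -/

section Curvature

variable {I : Set ℝ} {P : Space d → ℝ → FiberSpace γ →L[ℂ] FiberSpace γ}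

lemma dk_isSelfAdjoint {t : ℝ} (hP : ∀ k, IsStarProjection (P k t)) (j : Fin d) (k : Space d) :
    IsSelfAdjoint (dk P j k t) := by
  rw [dk, ← fderivWithin_univ]
  exact fderivWithin_isSelfAdjoint uniqueDiffWithinAt_univ (Set.mem_univ k)
    (fun q _ => (hP q).isSelfAdjoint) _

lemma dk_eq_mul_add {t : ℝ} (hP : ∀ k, IsStarProjection (P k t)) (j : Fin d) (k : Space d) :
    dk P j k t = P k t * dk P j k t + dk P j k t * P k t := by
  rw [dk, ← fderivWithin_univ]
  exact fderivWithin_eq_mul_add (F := fun q => P q t) uniqueDiffWithinAt_univ (Set.mem_univ k)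
    (fun q _ => (hP q).isIdempotentElem) _

lemma dt_isSelfAdjoint (hI : UniqueDiffOn ℝ I) (hP : ∀ k, ∀ t ∈ I, IsStarProjection (P k t))
    {t : ℝ} (ht : t ∈ I) (k : Space d) : IsSelfAdjoint (dt I P k t) := by
  rw [dt, ← fderivWithin_derivWithin]
  exact fderivWithin_isSelfAdjoint (hI t ht) ht (fun s hs => (hP k s hs).isSelfAdjoint) _

lemma dt_eq_mul_add (hI : UniqueDiffOn ℝ I) (hP : ∀ k, ∀ t ∈ I, IsStarProjection (P k t))
    {t : ℝ} (ht : t ∈ I) (k : Space d) :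
    dt I P k t = P k t * dt I P k t + dt I P k t * P k t := by
  rw [dt, ← fderivWithin_derivWithin]
  exact fderivWithin_eq_mul_add (hI t ht) ht (fun s hs => (hP k s hs).isIdempotentElem) _

/-- Off-diagonal elements interchange the two blocks of `p`, so a product of two of them is block
diagonal. -/
lemma commute_mul_of_offDiagonal {R : Type*} [Ring R] {p a b : R} (ha : a = p * a + a * p)
    (hb : b = p * b + b * p) : p * (a * b) = a * b * p := by
  have h1 : p * a = a - a * p := eq_sub_of_add_eq ha.symm
  have h2 : p * b = b - b * p := eq_sub_of_add_eq hb.symm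
  rw [← mul_assoc, h1, sub_mul, mul_assoc a p b, h2, mul_sub, mul_assoc]
  abel

/-- The operator `P [∂_t P, ∂_j P]` is antiselfadjoint, since `∂_t P` and `∂_j P` are off-diagonal
with respect to `P`. -/
lemma star_curvatureOp (hI : UniqueDiffOn ℝ I) (hP : ∀ k, ∀ t ∈ I, IsStarProjection (P k t))
    {t : ℝ} (ht : t ∈ I) (j : Fin d) (k : Space d) :
    star (curvatureOp I P j k t) = -curvatureOp I P j k t := by
  have a1 := dt_eq_mul_add hI hP ht k
  have b1 := dk_eq_mul_add (fun k => hP k t ht) j k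
  have c1 := commute_mul_of_offDiagonal a1 b1
  have c2 := commute_mul_of_offDiagonal b1 a1
  rw [curvatureOp, star_mul, star_sub, star_mul, star_mul, (hP k t ht).isSelfAdjoint.star_eq,
    (dt_isSelfAdjoint hI hP ht k).star_eq, (dk_isSelfAdjoint (fun k => hP k t ht) j k).star_eq,
    sub_mul, mul_sub, ← c1, ← c2, neg_sub]

variable (J : FiberSpace γ ≃ₗᵢ⋆[ℂ] FiberSpace γ)

lemma dk_neg {t : ℝ} (hJ : ∀ k, P (-k) t = conjOp J (P k t)) (j : Fin d) (k : Space d) :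
    dk P j (-k) t = -conjOp J (dk P j k t) :=
  fderiv_neg_of_conjOp J hJ _

lemma differentiableWithinAt_neg_iff (hJ : ∀ k, ∀ t ∈ I, P (-k) t = conjOp J (P k t)) {t : ℝ}
    (ht : t ∈ I) (k : Space d) :
    DifferentiableWithinAt ℝ (fun s => P (-k) s) I t ↔
      DifferentiableWithinAt ℝ (fun s => P k s) I t := by
  refine Iff.trans ⟨fun h => ?_, fun h => ?_⟩ (differentiableWithinAt_conjOp_iff J)
  · exact h.congr (fun s hs => (hJ k s hs).symm) (hJ k t ht).symm
  · exact h.congr (fun s hs => hJ k s hs) (hJ k t ht)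

lemma dt_neg (hI : UniqueDiffOn ℝ I) (hJ : ∀ k, ∀ t ∈ I, P (-k) t = conjOp J (P k t)) {t : ℝ}
    (ht : t ∈ I) (k : Space d) : dt I P (-k) t = conjOp J (dt I P k t) := by
  rw [dt, derivWithin_congr (fun s hs => hJ k s hs) (hJ k t ht), dt, ← fderivWithin_derivWithin,
    ← fderivWithin_derivWithin]
  exact fderivWithin_conjOp J (hI t ht) 1

lemma curvatureOp_neg (hI : UniqueDiffOn ℝ I) (hJ : ∀ k, ∀ t ∈ I, P (-k) t = conjOp J (P k t))
    {t : ℝ} (ht : t ∈ I) (j : Fin d) (k : Space d) :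
    curvatureOp I P j (-k) t = conjOp J (-curvatureOp I P j k t) := by
  rw [curvatureOp, curvatureOp, hJ k t ht, dt_neg J hI hJ ht,
    dk_neg J (fun k => hJ k t ht), ← mul_neg, neg_sub, conjOp_mul, conjOp_sub, conjOp_mul,
    conjOp_mul]
  congr 1
  rw [mul_neg, neg_mul]
  abel

lemma hasTrace_curvatureOp_neg (hI : UniqueDiffOn ℝ I)
    (hP : ∀ k, ∀ t ∈ I, IsStarProjection (P k t))
    (hJ : ∀ k, ∀ t ∈ I, P (-k) t = conjOp J (P k t)) {t : ℝ} (ht : t ∈ I) (j : Fin d)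
    (k : Space d) (z : ℂ) :
    HasTrace (curvatureOp I P j (-k) t) z ↔ HasTrace (curvatureOp I P j k t) z := by
  have key (k : Space d) (h : HasTrace (curvatureOp I P j k t) z) :
      HasTrace (curvatureOp I P j (-k) t) z := by
    -- The minus sign from `∂_k` is absorbed into the adjoint, whose trace is conjugated once more
    -- by `J`.
    rw [curvatureOp_neg J hI hJ ht, ← star_curvatureOp hI hP ht]
    simpa using h.star.conjOp J
  exact ⟨fun h => by simpa using key (-k) h, key k⟩

end Curvature

end Piezo

end

theorem mainTheorem5 {d : ℕ} (γ : Module.Basis (Fin d) ℝ (Piezo.Space d))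
    (I : Set ℝ) (hI : I.OrdConnected) (hI' : I.Nontrivial)
    (H : ℝ → Piezo.L2 d →ₗ.[ℂ] Piezo.L2 d)
    (hH : ∀ t ∈ I, IsSelfAdjoint (H t))
    (hC : ∀ t ∈ I, Piezo.CommutesWithConj (H t))
    (h : Piezo.Space d → ℝ → Piezo.FiberSpace γ →ₗ.[ℂ] Piezo.FiberSpace γ)
    (hh : ∀ t ∈ I, Piezo.IsContinuouslyFibered γ (H t) (fun k => h k t))
    (P : Piezo.Space d → ℝ → Piezo.FiberSpace γ →L[ℂ] Piezo.FiberSpace γ)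
    (hP : Piezo.IsFermiProjector γ I H h P ∨ Piezo.IsBlochProjector γ I h P) :
    (∀ k, ∀ t ∈ I, ∀ φ, P k t φ = star (P (-k) t (star φ))) ∧
    (∀ k, ∀ t ∈ I,
      (Piezo.PiezocurvatureExists I P (-k) t ↔ Piezo.PiezocurvatureExists I P k t) ∧
      Piezo.piezocurvature I P (-k) t = Piezo.piezocurvature I P k t) := by
  have hproj (k : Piezo.Space d) (t : ℝ) (ht : t ∈ I) : IsStarProjection (P k t) :=
    hP.elim (fun hP => hP.isStarProjection ht k) (fun hP => hP.isStarProjection ht k)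
  have hsymm (k : Piezo.Space d) (t : ℝ) (ht : t ∈ I) :
      P k t = Piezo.conjOp (Piezo.fiberConj γ) (P (-k) t) :=
    hP.elim (fun hP => hP.eq_conjOp ht (hC t ht) (hh t ht) k)
      (fun hP => hP.eq_conjOp ht (hC t ht) (hh t ht) k)
  have hJ (k : Piezo.Space d) (t : ℝ) (ht : t ∈ I) :
      P (-k) t = Piezo.conjOp (Piezo.fiberConj γ) (P k t) := by
    rw [hsymm (-k) t ht, neg_neg]
  -- Positive length makes derivatives within `I` unique, also at endpoints belonging to `I`.
  have hU : UniqueDiffOn ℝ I :=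
    uniqueDiffOn_convex hI.convex (hI.convex.nontrivial_iff_nonempty_interior.mp hI')
  refine ⟨fun k t ht φ => ?_, fun k t ht => ⟨?_, ?_⟩⟩
  · exact DFunLike.congr_fun (hsymm k t ht) φ
  · have hk := Piezo.differentiableAt_neg_iff_of_conjOp (F := fun q => P q t) (x := k)
      (Piezo.fiberConj γ) (fun k => hJ k t ht)
    have ht' := Piezo.differentiableWithinAt_neg_iff (Piezo.fiberConj γ) hJ ht k
    have htr (j : Fin d) : Piezo.IsTraceClass (Piezo.curvatureOp I P j (-k) t) ↔
        Piezo.IsTraceClass (Piezo.curvatureOp I P j k t) :=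
      exists_congr (Piezo.hasTrace_curvatureOp_neg (Piezo.fiberConj γ) hU hproj hJ ht j k)
    exact ⟨fun h => ⟨hk.mp h.1, ht'.mp h.2, fun j => (htr j).mp (h.3 j)⟩,
      fun h => ⟨hk.mpr h.1, ht'.mpr h.2, fun j => (htr j).mpr (h.3 j)⟩⟩
  -- No existence assumption enters: the symmetries of the derivatives and of `HasTrace` also hold
  -- for the default values.
  · funext j
    rw [Piezo.piezocurvature, Piezo.piezocurvature, Piezo.trace_congr
      (Piezo.hasTrace_curvatureOp_neg (Piezo.fiberConj γ) hU hproj hJ ht j k)]
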